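/- Let $F$ be a non-Archimedean local field with ring of integers $\mathcal O$, uniformiser $\varpi$ and residue field $k$ of characteristic $p$, let $n\ge 0$, and let $R$ be an algebraically closed field of characteristic $l\neq p$. Put $G=\mathrm{GL}_n(F)$, $K=\mathrm{GL}_n(\mathcal O)$, $K^1=1+\varpi M_n(\mathcal O)\subseteq K$ and $G_f=\mathrm{GL}_n(k)=K/K^1$. Let $B_f\subseteq G_f$ be the subgroup of upper triangular matrices and $I\subseteq K$ its preimage. Let $\mathcal H(G)$ be the algebra of locally constant, compactly supported functions $G\to R$ under convolution with respect to the $R$-valued Haar measure on $G$ giving $K^1$ volume $1$; let $\mathcal H(K)\subseteq\mathcal H(G)$ be the subalgebra of functions supported on $K$, and let $\mathcal H(G_f)=R[G_f]$. View $\mathcal H(G_f)$ as a left $\mathcal H(K)$-module through the homomorphism $\mathcal H(K)\to\mathcal H(G_f)$, $f\mapsto 1_{K^1}f1_{K^1}$, where $1_{gK^1}$ ($g\in K$) is identified with the image of $g$ in $G_f$. Let $\mathcal I$ be the annihilator in $\mathcal H(G)$ of the compactly induced representation $\mathrm{ind}_I^G\mathbf 1$, and let $\mathcal I_f$ be the annihilator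 in $\mathcal H(G_f)$ of $\mathrm{ind}_{B_f}^{G_f}\mathbf 1$. Then $$\mathcal H(G)\otimes_{\mathcal H(K)}\mathcal I_f=\mathcal I\otimes_{\mathcal H(K)}\mathcal H(G_f)$$ as subsets of $\mathcal H(G)\otimes_{\mathcal H(K)}\mathcal H(G_f)$, where the left (right) side denotes the subspace spanned by the $f\otimes z$ with $f\in\mathcal H(G)$, $z\in\mathcal I_f$ (with $f\in\mathcal I$, $z\in\mathcal H(G_f)$). -/

import Mathlib

open scoped ValuativeRel TensorProduct Pointwise

noncomputable section

namespace Hecke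

section General

variable (R : Type*) [Field R] {G : Type*} [Group G] [TopologicalSpace G]

/-- The integral of a locally constant compactly supported function `φ : G → V`, for the
`R`-valued left Haar measure on `G` that gives the compact open subgroup `U₀` volume `1`:
if `φ` is right invariant under an open subgroup `U ≤ U₀`, it is
`[U₀ : U]⁻¹ ∑_{x ∈ G/U} φ(x)`. (It does not depend on `U`, see `haarIntegral_eq`.) -/
def haarIntegral (U₀ : Subgroup G) {V : Type*} [AddCommGroup V] [Module R V] (φ : G → V) : V :=
  open Classical in
  if h : ∃ U : Subgroup G, IsOpen (U : Set G) ∧ U ≤ U₀ ∧ ∀ g, ∀ u ∈ U, φ (g * u) = φ g then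
    ((h.choose.relIndex U₀ : ℕ) : R)⁻¹ • ∑ᶠ x : G ⧸ h.choose, φ x.out
  else 0

/-- The space of locally constant, compactly supported functions `G → R`. -/
def heckeSubmodule (G : Type*) [Group G] [TopologicalSpace G] : Submodule R (G → R) where
  carrier := {f | IsLocallyConstant f ∧ HasCompactSupport f}
  zero_mem' := ⟨IsLocallyConstant.const 0, HasCompactSupport.zero⟩
  add_mem' hf hg := ⟨hf.1.add hg.1, hf.2.add hg.2⟩
  smul_mem' c _ hf := ⟨hf.1.comp (c • ·), hf.2.smul_left (f := fun _ => c)⟩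

/-- The global Hecke algebra `H(G)` of locally constant, compactly supported functions `G → R`.
Its product is the convolution `HeckeAlgebra.mul`. -/
def HeckeAlgebra (G : Type*) [Group G] [TopologicalSpace G] : Type _ := heckeSubmodule R G

instance (G : Type*) [Group G] [TopologicalSpace G] : AddCommGroup (HeckeAlgebra R G) :=
  inferInstanceAs (AddCommGroup (heckeSubmodule R G))

instance (G : Type*) [Group G] [TopologicalSpace G] : Module R (HeckeAlgebra R G) :=
  inferInstanceAs (Module R (heckeSubmodule R G))

/-- Convolution of functions on `G`: `(f * h)(x) = ∫ f(g) h(g⁻¹ x) dg`, where the Haar measure is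
normalised by `vol(U₀) = 1`. -/
def convolution (U₀ : Subgroup G) (f h : G → R) (x : G) : R :=
  haarIntegral R U₀ fun g => f g * h (g⁻¹ * x)

/-- The action of a function `f` on `G` on a vector `v` of a representation `ρ` of `G`:
`f v = ∫ f(g) ρ(g) v dg`. -/
def act (U₀ : Subgroup G) {V : Type*} [AddCommGroup V] [Module R V] (ρ : Representation R G V)
    (f : G → R) (v : V) : V :=
  haarIntegral R U₀ fun g => f g • ρ g v

/-- The annihilator in the Hecke algebra of a (smooth) representation of `G`. -/
def annihilator (U₀ : Subgroup G) {V : Type*} [AddCommGroup V] [Module R V]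
    (ρ : Representation R G V) : Set (HeckeAlgebra R G) :=
  {f | ∀ v, act R U₀ ρ f.1 v = 0}

variable {R}

/-- The integral may be computed with any open subgroup `U ≤ U₀` under which the function is right
invariant, as soon as the indices of open subgroups in `U₀` are finite and invertible in `R`
(for instance if `U₀` is a pro-`p` group and `p` is invertible in `R`). -/
theorem haarIntegral_eq [IsTopologicalGroup G] (U₀ : Subgroup G)
    (hU₀ : ∀ U : Subgroup G, IsOpen (U : Set G) → U ≤ U₀ → ((U.relIndex U₀ : ℕ) : R) ≠ 0)
    {V : Type*} [AddCommGroup V] [Module R V] (φ : G → V) (hφ : HasCompactSupport φ)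
    (U : Subgroup G) (hU : IsOpen (U : Set G)) (hUU₀ : U ≤ U₀)
    (hinv : ∀ g, ∀ u ∈ U, φ (g * u) = φ g) :
    haarIntegral R U₀ φ = ((U.relIndex U₀ : ℕ) : R)⁻¹ • ∑ᶠ x : G ⧸ U, φ x.out := by
  have out_eq : ∀ (W : Subgroup G), (∀ g, ∀ u ∈ W, φ (g * u) = φ g) →
      ∀ g : G, φ (g : G ⧸ W).out = φ g := by
    intro W hW g
    obtain ⟨h, hh⟩ := QuotientGroup.mk_out_eq_mul W g
    rw [hh, hW g _ h.2]
  have fin : ∀ (W : Subgroup G), IsOpen (W : Set G) → (∀ g, ∀ u ∈ W, φ (g * u) = φ g) →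
      (Function.support fun x : G ⧸ W => φ x.out).Finite := by
    intro W hWo hW
    have : DiscreteTopology (G ⧸ W) := QuotientGroup.discreteTopology hWo
    have hc : IsCompact ((fun g : G => (g : G ⧸ W)) '' tsupport φ) :=
      hφ.isCompact.image QuotientGroup.continuous_mk
    refine (isCompact_iff_finite.mp hc).subset ?_
    intro x hx
    exact ⟨x.out, subset_tsupport _ hx, by simp⟩
  have step : ∀ (W W' : Subgroup G), IsOpen (W : Set G) → IsOpen (W' : Set G) → W' ≤ W →
      W ≤ U₀ → (∀ g, ∀ u ∈ W, φ (g * u) = φ g) →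
      ((W'.relIndex U₀ : ℕ) : R)⁻¹ • ∑ᶠ x : G ⧸ W', φ x.out =
      ((W.relIndex U₀ : ℕ) : R)⁻¹ • ∑ᶠ x : G ⧸ W, φ x.out := by
    intro W W' hWo hWo' hle hWU hW
    have hW' : ∀ g, ∀ u ∈ W', φ (g * u) = φ g := fun g u hu => hW g u (hle hu)
    have hmul : W'.relIndex W * W.relIndex U₀ = W'.relIndex U₀ :=
      Subgroup.relIndex_mul_relIndex _ _ _ hle hWU
    have hne := hU₀ W' hWo' (hle.trans hWU)
    rw [← hmul, Nat.cast_mul] at hne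
    have hi : W'.relIndex W ≠ 0 := by
      intro h0; simp [h0] at hne
    have : Finite (W ⧸ W'.subgroupOf W) := Nat.finite_of_card_ne_zero hi
    let e := Subgroup.quotientEquivProdOfLE hle
    have key : ∀ a, φ a.out = φ (e a).1.out := by
      intro a
      induction a using QuotientGroup.induction_on with
      | H g => rw [out_eq W' hW']; exact (out_eq W hW g).symm
    have h1 : ∑ᶠ x : G ⧸ W', φ x.out = ∑ᶠ y : (G ⧸ W) × (W ⧸ W'.subgroupOf W), φ y.1.out :=
      finsum_eq_of_bijective e e.bijective key
    have h2 : (Function.support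
        fun y : (G ⧸ W) × (W ⧸ W'.subgroupOf W) => φ y.1.out).Finite := by
      refine ((fin W hWo hW).prod (Set.finite_univ (α := W ⧸ W'.subgroupOf W))).subset ?_
      intro y hy
      exact ⟨hy, trivial⟩
    have h3 : ∀ v : V, ∑ᶠ _ : W ⧸ W'.subgroupOf W, v = ((W'.relIndex W : ℕ) : R) • v := by
      intro v
      have := Fintype.ofFinite (W ⧸ W'.subgroupOf W)
      rw [finsum_eq_sum_of_fintype, Finset.sum_const, Finset.card_univ, Nat.cast_smul_eq_nsmul,
        ← Nat.card_eq_fintype_card]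
      rfl
    rw [h1, finsum_curry _ h2]
    simp only [h3]
    rw [← smul_finsum' _ (fin W hWo hW), smul_smul, ← hmul, Nat.cast_mul, mul_inv_rev, mul_assoc,
      inv_mul_cancel₀ (left_ne_zero_of_mul hne), mul_one]
  have h : ∃ U : Subgroup G, IsOpen (U : Set G) ∧ U ≤ U₀ ∧ ∀ g, ∀ u ∈ U, φ (g * u) = φ g :=
    ⟨U, hU, hUU₀, hinv⟩
  obtain ⟨ho, hl, hi⟩ := h.choose_spec
  have ho' : IsOpen ((h.choose ⊓ U : Subgroup G) : Set G) := by
    rw [Subgroup.coe_inf]; exact ho.inter hU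
  rw [haarIntegral, dif_pos h, ← step h.choose _ ho ho' inf_le_left hl hi,
    ← step U _ hU ho' inf_le_right hUU₀ hinv]

theorem convolution_mem [IsTopologicalGroup G] (U₀ : Subgroup G) {f h : G → R}
    (hf : f ∈ heckeSubmodule R G) (hh : h ∈ heckeSubmodule R G) :
    convolution R U₀ f h ∈ heckeSubmodule R G := by
  have int_zero : haarIntegral R U₀ (fun _ : G => (0 : R)) = 0 := by
    rw [haarIntegral]; split_ifs <;> simp
  constructor
  · rw [IsLocallyConstant.iff_eventually_eq]
    intro x₀
    have hop : IsOpen {y : G × G | h (y.1⁻¹ * y.2) = h (y.1⁻¹ * x₀)} := by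
      have hlc : IsLocallyConstant fun y : G × G => (h (y.1⁻¹ * y.2), h (y.1⁻¹ * x₀)) :=
        (hh.1.comp_continuous (f := fun y : G × G => y.1⁻¹ * y.2) (by fun_prop)).prodMk
          (hh.1.comp_continuous (f := fun y : G × G => y.1⁻¹ * x₀) (by fun_prop))
      exact hlc {p : R × R | p.1 = p.2}
    obtain ⟨u, v, -, hv, hu, hxv, huv⟩ := generalized_tube_lemma hf.2.isCompact
      (isCompact_singleton (x := x₀)) hop (by
        rintro ⟨a, b⟩ ⟨-, hb⟩
        simp only [Set.mem_singleton_iff] at hb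
        simp [hb])
    filter_upwards [hv.mem_nhds (hxv rfl)] with x hx
    unfold convolution
    congr 1
    funext g
    by_cases hg : f g = 0
    · simp [hg]
    · have : (g, x) ∈ {y : G × G | h (y.1⁻¹ * y.2) = h (y.1⁻¹ * x₀)} :=
        huv ⟨hu (subset_tsupport _ hg), hx⟩
      rw [show h (g⁻¹ * x) = h (g⁻¹ * x₀) from this]
  · refine HasCompactSupport.intro (hf.2.isCompact.mul hh.2.isCompact) ?_
    intro x hx
    have : (fun g => f g * h (g⁻¹ * x)) = fun _ => 0 := by
      funext g
      by_contra hne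
      refine hx ⟨g, subset_tsupport _ (left_ne_zero_of_mul hne), g⁻¹ * x,
        subset_tsupport _ (right_ne_zero_of_mul hne), by simp⟩
    rw [convolution, this, int_zero]

/-- The product of the Hecke algebra. -/
def HeckeAlgebra.mul [IsTopologicalGroup G] (U₀ : Subgroup G) (f h : HeckeAlgebra R G) :
    HeckeAlgebra R G :=
  ⟨convolution R U₀ f.1 h.1, convolution_mem U₀ f.2 h.2⟩

variable (R)

/-- The space of the compactly induced representation `ind_H^G 1`: functions `φ : G → R` with
`φ (g h) = φ g` for `h ∈ H`, smooth under left translation and compactly supported modulo `H`. -/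
def CompactInd (H : Subgroup G) [IsTopologicalGroup G] : Submodule R (G → R) where
  carrier := {φ | (∀ g, ∀ h ∈ H, φ (g * h) = φ g) ∧
    (∃ V : Subgroup G, IsOpen (V : Set G) ∧ ∀ v ∈ V, ∀ g, φ (v * g) = φ g) ∧
    ∃ C : Set G, IsCompact C ∧ Function.support φ ⊆ C * (H : Set G)}
  zero_mem' := ⟨fun _ _ _ => rfl, ⟨⊤, isOpen_univ, fun _ _ _ => rfl⟩, ∅, isCompact_empty, by simp⟩
  add_mem' := by
    rintro φ ψ ⟨h1, ⟨V, hV, hV'⟩, C, hC, hC'⟩ ⟨k1, ⟨W, hW, hW'⟩, D, hD, hD'⟩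
    refine ⟨fun g h hh => by simp [h1 g h hh, k1 g h hh], ⟨V ⊓ W, ?_, ?_⟩, C ∪ D, hC.union hD, ?_⟩
    · rw [Subgroup.coe_inf]; exact hV.inter hW
    · intro v hv g
      simp [hV' v hv.1 g, hW' v hv.2 g]
    · rw [Set.union_mul]
      exact (Function.support_add φ ψ).trans (Set.union_subset_union hC' hD')
  smul_mem' := by
    rintro c φ ⟨h1, ⟨V, hV, hV'⟩, C, hC, hC'⟩
    refine ⟨fun g h hh => by simp [h1 g h hh], ⟨V, hV, fun v hv g => by simp [hV' v hv g]⟩,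
      C, hC, (Function.support_const_smul_subset c φ).trans hC'⟩

/-- The compactly induced representation `ind_H^G 1`: `G` acts on `CompactInd R H` by left
translation, `(g φ)(x) = φ (g⁻¹ x)`. -/
def compactInd [IsTopologicalGroup G] (H : Subgroup G) :
    Representation R G (CompactInd R H) where
  toFun g :=
    { toFun := fun φ => ⟨fun x => φ.1 (g⁻¹ * x), by
        obtain ⟨φ, h1, ⟨V, hV, hV'⟩, C, hC, hC'⟩ := φ
        refine ⟨fun x h hh => by simp [← mul_assoc, h1 _ h hh],
          ⟨V.comap (MulAut.conj g⁻¹).toMonoidHom, ?_, ?_⟩, g • C, hC.smul g, ?_⟩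
        · exact hV.preimage (f := fun x => MulAut.conj g⁻¹ x) (by simp only [MulAut.conj_apply]; fun_prop)
        · intro v hv x
          have := hV' _ (Subgroup.mem_comap.mp hv) (g⁻¹ * x)
          simpa [mul_assoc] using this
        · intro x hx
          obtain ⟨c, hc, h, hh, hch⟩ := hC' (show g⁻¹ * x ∈ Function.support φ from hx)
          refine ⟨g * c, ⟨c, hc, rfl⟩, h, hh, ?_⟩
          simp only at hch
          simp [mul_assoc, hch]⟩
      map_add' := fun _ _ => rfl
      map_smul' := fun _ _ => rfl }
  map_one' := by ext; simp
  map_mul' g h := by ext; simp [mul_assoc]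

end General

section GLn

variable (F : Type*) [Field F] [ValuativeRel F] [TopologicalSpace F] [IsNonarchimedeanLocalField F]
  (n : ℕ)

/-- The group `G = GL_n(F)`. -/
abbrev GLF := Matrix.GeneralLinearGroup (Fin n) F

/-- The finite group `G_f = GL_n(k)`, with `k` the residue field of `F`. -/
abbrev GLk := Matrix.GeneralLinearGroup (Fin n) 𝓀[F]

/-- The inclusion `GL_n(𝒪) → GL_n(F)`. -/
def incl : Matrix.GeneralLinearGroup (Fin n) 𝒪[F] →* GLF F n :=
  Matrix.GeneralLinearGroup.map (algebraMap 𝒪[F] F)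

/-- The reduction map `GL_n(𝒪) → GL_n(k)`. -/
def red : Matrix.GeneralLinearGroup (Fin n) 𝒪[F] →* GLk F n :=
  Matrix.GeneralLinearGroup.map (IsLocalRing.residue 𝒪[F])

/-- `K = GL_n(𝒪)` as a subgroup of `G`. -/
def maxCompact : Subgroup (GLF F n) := (incl F n).range

/-- The pro-`p` radical `K¹ = 1 + ϖ M_n(𝒪)` of `K`: the matrices of `K` that reduce to `1`. -/
def proRadical : Subgroup (GLF F n) := (red F n).ker.map (incl F n)

/-- The subgroup `B_f` of upper triangular matrices of `G_f`. -/
def borel : Subgroup (GLk F n) where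
  carrier := {g | (g : Matrix (Fin n) (Fin n) 𝓀[F]).BlockTriangular id}
  one_mem' := Matrix.blockTriangular_one
  mul_mem' ha hb := Matrix.BlockTriangular.mul ha hb
  inv_mem' {g} hg := by
    have : Invertible (g : Matrix (Fin n) (Fin n) 𝓀[F]) := g.invertible
    have h := Matrix.blockTriangular_inv_of_blockTriangular
      (M := (g : Matrix (Fin n) (Fin n) 𝓀[F])) hg
    rw [← Matrix.coe_units_inv] at h
    exact h

/-- The Iwahori subgroup `I`, the preimage of `B_f` under `K → G_f`. -/
def iwahori : Subgroup (GLF F n) := ((borel F n).comap (red F n)).map (incl F n)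

theorem red_surjective : Function.Surjective (red F n) := by
  intro g
  choose s hs using IsLocalRing.residue_surjective (R := 𝒪[F])
  let M : Matrix (Fin n) (Fin n) 𝒪[F] := (g : Matrix (Fin n) (Fin n) 𝓀[F]).map s
  have hM : M.map (IsLocalRing.residue 𝒪[F]) = g := by
    ext i j; exact hs _
  have hdet : IsUnit M.det := by
    refine isUnit_of_map_unit (IsLocalRing.residue 𝒪[F]) _ ?_
    rw [RingHom.map_det, RingHom.mapMatrix_apply, hM]
    exact (Matrix.isUnit_iff_isUnit_det _).mp g.isUnit
  refine ⟨M.nonsingInvUnit hdet, ?_⟩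
  ext i j
  exact hs _

variable (R : Type*) [Field R]

/-- `H(K)`: the elements of `H(G)` that are supported on `K`. -/
def heckeK : Set (HeckeAlgebra R (GLF F n)) :=
  {f | Function.support f.1 ⊆ maxCompact F n}

/-- The map `H(K) → H(G_f) = R[G_f]`, `f ↦ 1_{K¹} f 1_{K¹}`, where a function on `K` that is
bi-invariant under `K¹` is identified with an element of `R[G_f]` through `1_{gK¹} ↔ g`:
the coefficient at `g ∈ G_f` is the value at any lift of `g` to `K`. -/
def toFinite (f : HeckeAlgebra R (GLF F n)) : MonoidAlgebra R (GLk F n) :=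
  MonoidAlgebra.ofCoeff <| Finsupp.equivFunOnFinite.symm fun g =>
    let e : GLF F n → R := Set.indicator (proRadical F n : Set (GLF F n)) 1
    convolution R (proRadical F n) (convolution R (proRadical F n) e f.1) e
      (incl F n (Function.surjInv (red_surjective F n) g))

/-- The relations `f k ⊗ z = f ⊗ k z` (`k ∈ H(K)`) defining the tensor product over `H(K)`. -/
def balancedRel : Submodule R (HeckeAlgebra R (GLF F n) ⊗[R] MonoidAlgebra R (GLk F n)) :=
  Submodule.span R {t | ∃ (f : HeckeAlgebra R (GLF F n)), ∃ k ∈ heckeK F n R,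
    ∃ z : MonoidAlgebra R (GLk F n),
      t = HeckeAlgebra.mul (proRadical F n) f k ⊗ₜ[R] z - f ⊗ₜ[R] (toFinite F n R k * z)}

/-- `H(G) ⊗_{H(K)} H(G_f)`. -/
abbrev HeckeTensor :=
  (HeckeAlgebra R (GLF F n) ⊗[R] MonoidAlgebra R (GLk F n)) ⧸ balancedRel F n R

/-- The class of `f ⊗ z` in `H(G) ⊗_{H(K)} H(G_f)`. -/
def tmul (f : HeckeAlgebra R (GLF F n)) (z : MonoidAlgebra R (GLk F n)) : HeckeTensor F n R :=
  (balancedRel F n R).mkQ (f ⊗ₜ[R] z)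

/-- For `A ⊆ H(G)` and `B ⊆ H(G_f)`, the subspace `A ⊗_{H(K)} B` of `H(G) ⊗_{H(K)} H(G_f)`
spanned by the `f ⊗ z` with `f ∈ A` and `z ∈ B`. -/
def tensorSpan (A : Set (HeckeAlgebra R (GLF F n))) (B : Set (MonoidAlgebra R (GLk F n))) :
    Submodule R (HeckeTensor F n R) :=
  Submodule.span R {t | ∃ f ∈ A, ∃ z ∈ B, t = tmul F n R f z}

/-- `𝓘`: the annihilator in `H(G)` of `ind_I^G 1`. -/
def annP : Set (HeckeAlgebra R (GLF F n)) :=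
  annihilator R (proRadical F n) (compactInd R (iwahori F n))

/-- `𝓘_f`: the annihilator in `H(G_f) = R[G_f]` of `ind_{B_f}^{G_f} 1`. -/
def annPf : Ideal (MonoidAlgebra R (GLk F n)) :=
  Module.annihilator (MonoidAlgebra R (GLk F n))
    (Representation.ind (borel F n).subtype (Representation.trivial R (borel F n) R)).asModule

end GLn

end Hecke

end

/-! Inflating `z ∈ H(G_f)` to a bi-`K¹`-invariant function on `K` gives `f ⊗ z = (f * infl z) ⊗ 1`,
and both inclusions reduce to statements about inflated functions.

If `z` annihilates `ind_{B_f}^{G_f} 1`, then `infl z` annihilates `ind_I^G 1`: for every `x ∈ G`,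
the image of `K ∩ x I x⁻¹` in `G_f` contains a conjugate of `B_f`. As `G = K T I`, with `T` the
group of diagonal matrices, by an elimination whose pivots are the entries of maximal valuation,
this is only needed for diagonal `x`; sort its entries by valuation.

Conversely, a right `K¹`-invariant `f` is cut along the cosets `x K` into translates of inflated
functions. If `f` annihilates `ind_I^G 1`, each piece is an inflation from the annihilator of
`ind_{B_f}^{G_f} 1`, because on functions supported on `K` only the piece on `x K` contributes to
the values on `x K`. -/

namespace Hecke

section Integration

variable {R : Type*} [Field R] {G : Type*} [Group G] {V : Type*} [AddCommGroup V] [Module R V]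
  {W : Type*} [AddCommGroup W] [Module R W]

theorem apply_out_of_mul_right_eq {α : Type*} {φ : G → α} {U : Subgroup G}
    (hφ : ∀ g, ∀ u ∈ U, φ (g * u) = φ g) (g : G) : φ (g : G ⧸ U).out = φ g := by
  obtain ⟨u, hu⟩ := QuotientGroup.mk_out_eq_mul U g
  rw [hu, hφ g _ u.2]

theorem indicator_mul_right_eq {U : Subgroup G} (g : G) {u : G} (hu : u ∈ U) :
    Set.indicator (U : Set G) (1 : G → R) (g * u) = Set.indicator (U : Set G) 1 g := by
  classical
  simp only [Set.indicator_apply, SetLike.mem_coe, U.mul_mem_cancel_right hu, Pi.one_apply]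

theorem indicator_mul_left_eq {U : Subgroup G} (g : G) {u : G} (hu : u ∈ U) :
    Set.indicator (U : Set G) (1 : G → R) (u * g) = Set.indicator (U : Set G) 1 g := by
  classical
  simp only [Set.indicator_apply, SetLike.mem_coe, U.mul_mem_cancel_left hu, Pi.one_apply]

variable [TopologicalSpace G]

/-- A vector of a representation is smooth if it is fixed by an open subgroup. -/
def IsSmooth (ρ : Representation R G V) (v : V) : Prop :=
  ∃ U : Subgroup G, IsOpen (U : Set G) ∧ ∀ u ∈ U, ρ u v = v

variable (R G V) in
/-- The functions that `haarIntegral` integrates: compactly supported, and right invariant under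
some open subgroup. -/
def testFunctions : Submodule R (G → V) where
  carrier := {φ | HasCompactSupport φ ∧
    ∃ U : Subgroup G, IsOpen (U : Set G) ∧ ∀ g, ∀ u ∈ U, φ (g * u) = φ g}
  zero_mem' := ⟨.zero, ⊤, isOpen_univ, fun _ _ _ => rfl⟩
  add_mem' := by
    rintro φ ψ ⟨hφ, U, hU, hφU⟩ ⟨hψ, U', hU', hψU'⟩
    exact ⟨hφ.add hψ, U ⊓ U', hU.inter hU', fun g u hu => by simp [hφU g u hu.1, hψU' g u hu.2]⟩
  smul_mem' := by
    rintro c φ ⟨hφ, U, hU, hφU⟩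
    exact ⟨hφ.smul_left (f := fun _ => c), U, hU, fun g u hu => by simp [hφU g u hu]⟩

/-- `U₀` is open and the indices in `U₀` of its open subgroups are finite and invertible in `R`, so
that there is an `R`-valued Haar measure giving `U₀` volume `1`. -/
structure IsNormalizing (R : Type*) [Field R] {G : Type*} [Group G] [TopologicalSpace G]
    (U₀ : Subgroup G) : Prop where
  isOpen : IsOpen (U₀ : Set G)
  relIndex_ne_zero : ∀ U : Subgroup G, IsOpen (U : Set G) → U ≤ U₀ →
    ((U.relIndex U₀ : ℕ) : R) ≠ 0

variable {U₀ : Subgroup G} {φ ψ : G → V}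

theorem map_mem_testFunctions (hφ : φ ∈ testFunctions R G V) (L : V →ₗ[R] W) :
    (fun g => L (φ g)) ∈ testFunctions R G W := by
  obtain ⟨hc, U, hU, hφU⟩ := hφ
  exact ⟨hc.comp_left (map_zero L), U, hU, fun g u hu => congrArg L (hφU g u hu)⟩

theorem exists_isOpen_le_mul_right_eq (hU₀ : IsOpen (U₀ : Set G)) (hφ : φ ∈ testFunctions R G V) :
    ∃ U : Subgroup G, IsOpen (U : Set G) ∧ U ≤ U₀ ∧ ∀ g, ∀ u ∈ U, φ (g * u) = φ g := by
  obtain ⟨-, U, hU, hφU⟩ := hφ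
  exact ⟨U ⊓ U₀, hU.inter hU₀, inf_le_right, fun g u hu => hφU g u hu.1⟩

theorem haarIntegral_zero : haarIntegral R U₀ (0 : G → V) = 0 := by
  rw [haarIntegral]
  split_ifs <;> simp

variable [IsTopologicalGroup G]

theorem finite_image_mk_support {α : Type*} [Zero α] {φ : G → α} (hφ : HasCompactSupport φ)
    {U : Subgroup G} (hU : IsOpen (U : Set G)) :
    (((↑) : G → G ⧸ U) '' Function.support φ).Finite := by
  have : DiscreteTopology (G ⧸ U) := QuotientGroup.discreteTopology hU
  have hcompact : IsCompact (((↑) : G → G ⧸ U) '' tsupport φ) :=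
    hφ.isCompact.image QuotientGroup.continuous_mk
  exact (isCompact_iff_finite.mp hcompact).subset (Set.image_mono (subset_tsupport φ))

theorem finite_support_out {α : Type*} [Zero α] {φ : G → α} (hφ : HasCompactSupport φ)
    {U : Subgroup G} (hU : IsOpen (U : Set G)) :
    (Function.support fun x : G ⧸ U => φ x.out).Finite :=
  (finite_image_mk_support hφ hU).subset fun x hx => ⟨x.out, hx, x.out_eq'⟩

theorem haarIntegral_add (h₀ : IsNormalizing R U₀) (hφ : φ ∈ testFunctions R G V)
    (hψ : ψ ∈ testFunctions R G V) :
    haarIntegral R U₀ (φ + ψ) = haarIntegral R U₀ φ + haarIntegral R U₀ ψ := by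
  obtain ⟨U, hU, hle, hφU⟩ := exists_isOpen_le_mul_right_eq h₀.isOpen hφ
  obtain ⟨U', hU', -, hψU'⟩ := exists_isOpen_le_mul_right_eq h₀.isOpen hψ
  have ho : IsOpen ((U ⊓ U' : Subgroup G) : Set G) := hU.inter hU'
  have hφ' : ∀ g, ∀ u ∈ U ⊓ U', φ (g * u) = φ g := fun g u hu => hφU g u hu.1
  have hψ' : ∀ g, ∀ u ∈ U ⊓ U', ψ (g * u) = ψ g := fun g u hu => hψU' g u hu.2
  have compute := fun (χ : G → V) (hχ : HasCompactSupport χ) =>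
    haarIntegral_eq U₀ h₀.relIndex_ne_zero χ hχ _ ho (inf_le_left.trans hle)
  rw [compute φ hφ.1 hφ', compute ψ hψ.1 hψ', compute (φ + ψ) (hφ.1.add hψ.1)
    (fun g u hu => by simp [hφ' g u hu, hψ' g u hu]), ← smul_add,
    ← finsum_add_distrib (finite_support_out hφ.1 ho) (finite_support_out hψ.1 ho)]
  rfl

theorem haarIntegral_map (h₀ : IsNormalizing R U₀) (hφ : φ ∈ testFunctions R G V)
    (L : V →ₗ[R] W) : haarIntegral R U₀ (fun g => L (φ g)) = L (haarIntegral R U₀ φ) := by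
  obtain ⟨U, hU, hle, hφU⟩ := exists_isOpen_le_mul_right_eq h₀.isOpen hφ
  rw [haarIntegral_eq U₀ h₀.relIndex_ne_zero φ hφ.1 U hU hle hφU,
    haarIntegral_eq U₀ h₀.relIndex_ne_zero (fun g => L (φ g)) (hφ.1.comp_left (map_zero L)) U hU
      hle (fun g u hu => by rw [hφU g u hu]), map_smul]
  congr 1
  exact (L.toAddMonoidHom.map_finsum (finite_support_out hφ.1 hU)).symm

theorem haarIntegral_mul_left (h₀ : IsNormalizing R U₀) (hφ : φ ∈ testFunctions R G V) (g : G) :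
    haarIntegral R U₀ (fun x => φ (g⁻¹ * x)) = haarIntegral R U₀ φ := by
  obtain ⟨U, hU, hle, hφU⟩ := exists_isOpen_le_mul_right_eq h₀.isOpen hφ
  have hφU' : ∀ x, ∀ u ∈ U, φ (g⁻¹ * (x * u)) = φ (g⁻¹ * x) :=
    fun x u hu => by rw [← mul_assoc, hφU _ u hu]
  have hcs : HasCompactSupport fun x => φ (g⁻¹ * x) :=
    hφ.1.comp_homeomorph (Homeomorph.mulLeft g⁻¹)
  rw [haarIntegral_eq U₀ h₀.relIndex_ne_zero φ hφ.1 U hU hle hφU,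
    haarIntegral_eq U₀ h₀.relIndex_ne_zero _ hcs U hU hle hφU']
  congr 1
  refine finsum_eq_of_bijective (fun x : G ⧸ U => g⁻¹ • x) (MulAction.bijective g⁻¹) fun x => ?_
  induction x using QuotientGroup.induction_on with
  | H x =>
    exact (apply_out_of_mul_right_eq (φ := fun x => φ (g⁻¹ * x)) hφU' x).trans
      (apply_out_of_mul_right_eq hφU (g⁻¹ * x)).symm

theorem haarIntegral_of_mul_right_eq (h₀ : IsNormalizing R U₀) (hφ : HasCompactSupport φ)
    (hφU₀ : ∀ g, ∀ u ∈ U₀, φ (g * u) = φ g) :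
    haarIntegral R U₀ φ = ∑ᶠ x : G ⧸ U₀, φ x.out := by
  rw [haarIntegral_eq U₀ h₀.relIndex_ne_zero φ hφ U₀ h₀.isOpen le_rfl hφU₀, Subgroup.relIndex_self,
    Nat.cast_one, inv_one, one_smul]

theorem haarIntegral_eq_apply (h₀ : IsNormalizing R U₀)
    (hc : IsCompact (U₀ : Set G)) (x : G) (hφ : ∀ g, ∀ u ∈ U₀, φ (g * u) = φ g)
    (hx : ∀ g, x⁻¹ * g ∉ U₀ → φ g = 0) : haarIntegral R U₀ φ = φ x := by
  have hcs : HasCompactSupport φ := .intro (hc.smul x) fun g hg =>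
    hx g fun h => hg ⟨x⁻¹ * g, h, by simp⟩
  rw [haarIntegral_of_mul_right_eq h₀ hcs hφ, finsum_eq_single _ (x : G ⧸ U₀),
    apply_out_of_mul_right_eq hφ]
  intro q hq
  refine hx _ fun h => hq ?_
  rw [← q.out_eq']
  exact (QuotientGroup.eq.mpr h).symm

end Integration

section Action

open scoped Topology

variable {R : Type*} [Field R] {G : Type*} [Group G] [TopologicalSpace G]
  {V : Type*} [AddCommGroup V] [Module R V] {W : Type*} [AddCommGroup W] [Module R W]
  {ρ : Representation R G V} {σ : Representation R G W} {v : V} {U₀ : Subgroup G} {f h : G → R}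

theorem act_of_apply_eq_zero (hv : ∀ g, ρ g v = 0) : act R U₀ ρ f v = 0 := by
  simp only [act, hv, smul_zero]
  exact haarIntegral_zero

theorem convolution_mul_right_eq (hh : ∀ g, ∀ u ∈ U₀, h (g * u) = h g) (g : G) {u : G}
    (hu : u ∈ U₀) : convolution R U₀ f h (g * u) = convolution R U₀ f h g := by
  simp only [convolution, ← mul_assoc, hh _ _ hu]

variable [IsTopologicalGroup G]

theorem isSmooth_of_eventually (hv : ∀ᶠ g in 𝓝 (1 : G), ρ g v = v) : IsSmooth ρ v := by
  let S : Subgroup G :=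
    { carrier := {g | ρ g v = v}
      one_mem' := by simp
      mul_mem' := fun {a b} ha hb => by
        rw [Set.mem_ofPred_eq, map_mul, Module.End.mul_apply, hb, ha]
      inv_mem' := fun {a} ha => by
        rw [Set.mem_ofPred_eq, ← ha, ← Module.End.mul_apply, ← map_mul, inv_mul_cancel, map_one,
          Module.End.one_apply, ha] }
  exact ⟨S, S.isOpen_of_mem_nhds hv, fun _ hu => hu⟩

variable (R G) in
/-- The representation of `G` on the Hecke algebra by left translation,
`(g f)(x) = f (g⁻¹ x)`. -/
def leftTranslation : Representation R G (heckeSubmodule R G) where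
  toFun g :=
    { toFun := fun f => ⟨fun x => f.1 (g⁻¹ * x),
        f.2.1.comp_continuous (continuous_const_mul g⁻¹),
        f.2.2.comp_homeomorph (Homeomorph.mulLeft g⁻¹)⟩
      map_add' := fun _ _ => rfl
      map_smul' := fun _ _ => rfl }
  map_one' := by ext; simp
  map_mul' g h := by ext; simp [mul_assoc]

theorem isSmooth_leftTranslation (f : heckeSubmodule R G) : IsSmooth (leftTranslation R G) f := by
  refine isSmooth_of_eventually ?_
  let _ := IsTopologicalGroup.rightUniformSpace G
  have : IsRightUniformGroup G := ⟨rfl⟩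
  let _ : UniformSpace R := ⊥
  have huc : UniformContinuous f.1 := f.2.2.uniformContinuous_of_continuous f.2.1.continuous
  have hnear : ∀ᶠ p in uniformity G, f.1 p.1 = f.1 p.2 := huc (Filter.mem_principal_self _)
  rw [uniformity_eq_comap_mul_inv_nhds_one, Filter.eventually_comap] at hnear
  filter_upwards [hnear] with u hu
  exact Subtype.ext (funext fun x => hu (u⁻¹ * x, x) (by simp))

theorem exists_isOpen_mul_right_eq (hf : f ∈ heckeSubmodule R G) :
    ∃ U : Subgroup G, IsOpen (U : Set G) ∧ ∀ g, ∀ u ∈ U, f (g * u) = f g := by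
  obtain ⟨U, hU, hfU⟩ := isSmooth_leftTranslation (R := R) (G := G) ⟨fun g => f g⁻¹,
    hf.1.comp_continuous continuous_inv, hf.2.comp_homeomorph (Homeomorph.inv G)⟩
  refine ⟨U, hU, fun g u hu => ?_⟩
  simpa [leftTranslation] using congrFun (congrArg Subtype.val (hfU u hu)) g⁻¹

theorem smul_mem_testFunctions (hf : f ∈ heckeSubmodule R G) (hv : IsSmooth ρ v) :
    (fun g => f g • ρ g v) ∈ testFunctions R G V := by
  obtain ⟨U, hU, hfU⟩ := exists_isOpen_mul_right_eq hf
  obtain ⟨U', hU', hvU'⟩ := hv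
  refine ⟨hf.2.smul_right, U ⊓ U', hU.inter hU', fun g u hu => ?_⟩
  beta_reduce
  rw [hfU g u hu.1, map_mul, Module.End.mul_apply, hvU' u hu.2]

theorem map_act (h₀ : IsNormalizing R U₀) (hv : IsSmooth ρ v) (hf : f ∈ heckeSubmodule R G)
    (L : V →ₗ[R] W) (hL : ∀ g, L (ρ g v) = σ g (L v)) :
    L (act R U₀ ρ f v) = act R U₀ σ f (L v) := by
  rw [act, act, ← haarIntegral_map h₀ (smul_mem_testFunctions hf hv)]
  simp only [map_smul, hL]

/-- The action on a fixed smooth vector `v`, as a function of the element of the Hecke algebra. -/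
noncomputable def orbitMap (h₀ : IsNormalizing R U₀) (hv : IsSmooth ρ v) :
    heckeSubmodule R G →ₗ[R] V where
  toFun f := act R U₀ ρ f.1 v
  map_add' f h := by
    rw [act, act, act, ← haarIntegral_add h₀ (smul_mem_testFunctions f.2 hv)
      (smul_mem_testFunctions h.2 hv)]
    simp only [Submodule.coe_add, Pi.add_apply, add_smul]
    rfl
  map_smul' c f := by
    rw [RingHom.id_apply, act, act, ← LinearMap.lsmul_apply c (haarIntegral R U₀ _),
      ← haarIntegral_map h₀ (smul_mem_testFunctions f.2 hv)]
    simp [smul_smul, mul_comm]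

theorem act_leftTranslation (h₀ : IsNormalizing R U₀) (hv : IsSmooth ρ v)
    (f : heckeSubmodule R G) (g : G) :
    act R U₀ ρ (leftTranslation R G g f).1 v = ρ g (act R U₀ ρ f.1 v) := by
  have hf := smul_mem_testFunctions f.2 hv
  rw [act, act, ← haarIntegral_map h₀ hf,
    ← haarIntegral_mul_left h₀ (map_mem_testFunctions hf (ρ g)) g]
  simp [leftTranslation, ← Module.End.mul_apply, ← map_mul]

theorem coe_act_leftTranslation (h₀ : IsNormalizing R U₀) (hf : f ∈ heckeSubmodule R G)
    (h : heckeSubmodule R G) :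
    (act R U₀ (leftTranslation R G) f h).1 = convolution R U₀ f h.1 := by
  funext x
  exact (haarIntegral_map h₀ (smul_mem_testFunctions hf (isSmooth_leftTranslation h))
    (LinearMap.proj x ∘ₗ (heckeSubmodule R G).subtype)).symm

theorem act_convolution (h₀ : IsNormalizing R U₀) (hv : IsSmooth ρ v)
    (hf : f ∈ heckeSubmodule R G) (hh : h ∈ heckeSubmodule R G) :
    act R U₀ ρ (convolution R U₀ f h) v = act R U₀ ρ f (act R U₀ ρ h v) := by
  rw [← coe_act_leftTranslation h₀ hf ⟨h, hh⟩]
  exact map_act h₀ (isSmooth_leftTranslation _) hf (orbitMap h₀ hv)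
    (act_leftTranslation h₀ hv ⟨h, hh⟩)

theorem isSmooth_compactInd (H : Subgroup G) (v : CompactInd R H) :
    IsSmooth (compactInd R H) v := by
  obtain ⟨φ, -, ⟨V, hV, hφV⟩, -⟩ := v
  exact ⟨V, hV, fun u hu => Subtype.ext (funext fun x => hφV _ (V.inv_mem hu) x)⟩

theorem indicator_mem_heckeSubmodule (ho : IsOpen (U₀ : Set G)) (hc : IsCompact (U₀ : Set G)) :
    Set.indicator (U₀ : Set G) (1 : G → R) ∈ heckeSubmodule R G :=
  ⟨(LocallyConstant.charFn R ⟨U₀.isClosed_of_isOpen ho, ho⟩).isLocallyConstant,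
    .intro hc fun _ hx => Set.indicator_of_notMem hx _⟩

theorem act_indicator_of_fixed (h₀ : IsNormalizing R U₀) (hc : IsCompact (U₀ : Set G))
    (hv : ∀ u ∈ U₀, ρ u v = v) : act R U₀ ρ (Set.indicator (U₀ : Set G) 1) v = v := by
  rw [act, haarIntegral_eq_apply h₀ hc 1]
  · simp [U₀.one_mem]
  · intro g u hu
    rw [indicator_mul_right_eq g hu, map_mul, Module.End.mul_apply, hv u hu]
  · intro g hg
    rw [Set.indicator_of_notMem (by simpa using hg), zero_smul]

theorem apply_act_indicator (h₀ : IsNormalizing R U₀) (hc : IsCompact (U₀ : Set G))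
    (hv : IsSmooth ρ v) {u : G} (hu : u ∈ U₀) :
    ρ u (act R U₀ ρ (Set.indicator (U₀ : Set G) 1) v) =
      act R U₀ ρ (Set.indicator (U₀ : Set G) 1) v := by
  rw [← act_leftTranslation h₀ hv ⟨_, indicator_mem_heckeSubmodule h₀.isOpen hc⟩]
  congr 1
  exact funext fun x => indicator_mul_left_eq x (U₀.inv_mem hu)

theorem convolution_leftTranslation (h₀ : IsNormalizing R U₀) (f h : heckeSubmodule R G) (g : G) :
    convolution R U₀ (leftTranslation R G g f).1 h.1 =
      fun x => convolution R U₀ f.1 h.1 (g⁻¹ * x) := by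
  rw [← coe_act_leftTranslation h₀ (leftTranslation R G g f).2,
    act_leftTranslation h₀ (isSmooth_leftTranslation h), ← coe_act_leftTranslation h₀ f.2]
  rfl

theorem convolution_indicator_left (h₀ : IsNormalizing R U₀) (hc : IsCompact (U₀ : Set G))
    (hh : h ∈ heckeSubmodule R G) (hinv : ∀ g, ∀ u ∈ U₀, h (u * g) = h g) :
    convolution R U₀ (Set.indicator (U₀ : Set G) 1) h = h := by
  rw [← coe_act_leftTranslation h₀ (indicator_mem_heckeSubmodule h₀.isOpen hc) ⟨h, hh⟩,
    act_indicator_of_fixed h₀ hc]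
  exact fun u hu => Subtype.ext (funext fun x => hinv x _ (U₀.inv_mem hu))

theorem convolution_indicator_right (h₀ : IsNormalizing R U₀) (hc : IsCompact (U₀ : Set G))
    (hinv : ∀ g, ∀ u ∈ U₀, f (g * u) = f g) :
    convolution R U₀ f (Set.indicator (U₀ : Set G) 1) = f := by
  funext y
  rw [convolution, haarIntegral_eq_apply h₀ hc y]
  · simp [U₀.one_mem]
  · intro g u hu
    rw [hinv g u hu, mul_inv_rev, mul_assoc, indicator_mul_left_eq _ (U₀.inv_mem hu)]
  · intro g hg
    rw [Set.indicator_of_notMem, mul_zero]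
    rwa [SetLike.mem_coe, ← U₀.inv_mem_iff, mul_inv_rev, inv_inv]

end Action

section Reduction

variable {R : Type*} [Field R] {G : Type*} [Group G] {K : Type*} [Group K] {Q : Type*} [Group Q]
  {i : K →* G} {r : K →* Q} {s : Q → K} {c : Q → R}

/-- The function on `G` supported on the image of `K`, where it is the pullback of `c`. This is
meaningful only if `i` is injective. -/
noncomputable def inflate (i : K →* G) (r : K →* Q) (c : Q → R) : G → R :=
  Function.extend i (c ∘ r) 0

theorem inflate_apply (hi : Function.Injective i) (k : K) : inflate i r c (i k) = c (r k) :=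
  hi.extend_apply _ _ k

theorem inflate_of_notMem_range {x : G} (hx : x ∉ i.range) : inflate i r c x = 0 :=
  Function.extend_apply' _ _ _ hx

theorem inflate_mul_left (hi : Function.Injective i) (k : K) (x : G) :
    inflate i r c (i k * x) = inflate i r (fun q => c (r k * q)) x := by
  by_cases hx : x ∈ i.range
  · obtain ⟨k', rfl⟩ := hx
    rw [← map_mul, inflate_apply hi, inflate_apply hi, map_mul]
  · rw [inflate_of_notMem_range hx, inflate_of_notMem_range]
    rwa [i.range.mul_mem_cancel_left ⟨k, rfl⟩]

theorem inflate_mul_right (hi : Function.Injective i) (k : K) (x : G) :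
    inflate i r c (x * i k) = inflate i r (fun q => c (q * r k)) x := by
  by_cases hx : x ∈ i.range
  · obtain ⟨k', rfl⟩ := hx
    rw [← map_mul, inflate_apply hi, inflate_apply hi, map_mul]
  · rw [inflate_of_notMem_range hx, inflate_of_notMem_range]
    rwa [i.range.mul_mem_cancel_right ⟨k, rfl⟩]

theorem inflate_mul_left_ker (hi : Function.Injective i) (x : G) :
    ∀ u ∈ r.ker.map i, inflate i r c (u * x) = inflate i r c x := by
  rintro _ ⟨k, hk, rfl⟩
  simp only [inflate_mul_left hi, MonoidHom.mem_ker.mp hk, one_mul]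

theorem inflate_mul_right_ker (hi : Function.Injective i) (x : G) :
    ∀ u ∈ r.ker.map i, inflate i r c (x * u) = inflate i r c x := by
  rintro _ ⟨k, hk, rfl⟩
  simp only [inflate_mul_right hi, MonoidHom.mem_ker.mp hk, mul_one]

theorem apply_mul_eq_of_map_eq {α : Type*} {φ : G → α} {x : G}
    (hφ : ∀ g, ∀ u ∈ r.ker.map i, φ (g * u) = φ g) {k k' : K} (h : r k = r k') :
    φ (x * i k) = φ (x * i k') := by
  rw [← hφ (x * i k') (i (k'⁻¹ * k)) ⟨_, by simp [h], rfl⟩, mul_assoc, ← map_mul,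
    mul_inv_cancel_left]

theorem inflate_apply_inv_mul (hi : Function.Injective i) (hs : ∀ q, r (s q) = q)
    {f : G → R} (hf : ∀ g, ∀ u ∈ r.ker.map i, f (g * u) = f g) {x y : G}
    (hxy : x⁻¹ * y ∈ i.range) : inflate i r (fun q => f (x * i (s q))) (x⁻¹ * y) = f y := by
  obtain ⟨k, hk⟩ := hxy
  rw [← hk, inflate_apply hi, apply_mul_eq_of_map_eq hf (hs (r k)), hk, mul_inv_cancel_left]

variable [TopologicalSpace G]

/-- The situation of `GL_n(F) ⊇ GL_n(𝒪) → GL_n(k)`: `i` embeds `K` as a compact subgroup of `G`, and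
`r` is a quotient map whose kernel is open in `G`. -/
structure IsReduction (i : K →* G) (r : K →* Q) : Prop where
  injective : Function.Injective i
  surjective : Function.Surjective r
  isOpen_ker : IsOpen (r.ker.map i : Set G)
  isCompact_range : IsCompact (i.range : Set G)

variable [IsTopologicalGroup G]

theorem IsReduction.isOpen_range (h : IsReduction i r) : IsOpen (i.range : Set G) :=
  Subgroup.isOpen_mono (Subgroup.map_le_range i r.ker) h.isOpen_ker

theorem IsReduction.isCompact_ker (h : IsReduction i r) : IsCompact (r.ker.map i : Set G) :=
  h.isCompact_range.of_isClosed_subset (Subgroup.isClosed_of_isOpen _ h.isOpen_ker)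
    (Subgroup.map_le_range i r.ker)

theorem isLocallyConstant_of_mul_right_eq {α : Type*} {φ : G → α} {U : Subgroup G}
    (hU : IsOpen (U : Set G)) (hφ : ∀ g, ∀ u ∈ U, φ (g * u) = φ g) : IsLocallyConstant φ := by
  refine (IsLocallyConstant.iff_eventually_eq φ).mpr fun x => ?_
  filter_upwards [(hU.smul x).mem_nhds ⟨1, U.one_mem, by simp⟩]
  rintro _ ⟨u, hu, rfl⟩
  exact hφ x u hu

theorem inflate_mem_heckeSubmodule (h : IsReduction i r) (c : Q → R) :
    inflate i r c ∈ heckeSubmodule R G :=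
  ⟨isLocallyConstant_of_mul_right_eq h.isOpen_ker (inflate_mul_right_ker h.injective),
    .intro h.isCompact_range fun _ => inflate_of_notMem_range⟩

theorem inflate_mem_compactInd (h : IsReduction i r) {B : Subgroup Q}
    (hc : ∀ q, ∀ b ∈ B, c (q * b) = c q) :
    inflate i r c ∈ CompactInd R ((B.comap r).map i) := by
  refine ⟨?_, ⟨r.ker.map i, h.isOpen_ker, fun u hu g => inflate_mul_left_ker h.injective g u hu⟩,
    i.range, h.isCompact_range, fun x hx => ⟨x, ?_, 1, one_mem _, mul_one x⟩⟩
  · rintro g _ ⟨k, hk, rfl⟩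
    simp only [inflate_mul_right h.injective, hc _ _ hk]
  · exact not_imp_comm.mp inflate_of_notMem_range hx

theorem exists_eq_sum_leftTranslation_inflate (h : IsReduction i r) (hs : ∀ q, r (s q) = q)
    (f : heckeSubmodule R G) (hf : ∀ g, ∀ u ∈ r.ker.map i, f.1 (g * u) = f.1 g) :
    ∃ T : Finset (G ⧸ i.range), f = ∑ x ∈ T, leftTranslation R G x.out
      ⟨inflate i r fun q => f.1 (x.out * i (s q)), inflate_mem_heckeSubmodule h _⟩ := by
  have hfin := finite_image_mk_support f.2.2 h.isOpen_range
  refine ⟨hfin.toFinset, Subtype.ext (funext fun y => ?_)⟩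
  have hout : (y : G ⧸ i.range).out⁻¹ * y ∈ i.range := by
    rw [← QuotientGroup.eq, QuotientGroup.out_eq']
  rw [Submodule.coe_sum, Finset.sum_apply, Finset.sum_eq_single (y : G ⧸ i.range)]
  · exact (inflate_apply_inv_mul h.injective hs hf hout).symm
  · intro x _ hx
    refine inflate_of_notMem_range fun hmem => hx ?_
    rw [← x.out_eq']
    exact QuotientGroup.eq.mpr hmem
  · intro hy
    refine (inflate_apply_inv_mul h.injective hs hf hout).trans ?_
    by_contra hne
    exact hy (hfin.mem_toFinset.mpr ⟨y, hne, rfl⟩)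

variable [Fintype Q] {V : Type*} [AddCommGroup V] [Module R V] {ρ : Representation R G V} {v : V}
  {f : G → R} {B : Subgroup Q} {H : Subgroup G}

theorem haarIntegral_eq_sum (h : IsReduction i r) (h₀ : IsNormalizing R (r.ker.map i))
    (hs : ∀ q, r (s q) = q) {φ : G → V} (x : G)
    (hφ : ∀ g, ∀ u ∈ r.ker.map i, φ (g * u) = φ g) (hx : ∀ g, x⁻¹ * g ∉ i.range → φ g = 0) :
    haarIntegral R (r.ker.map i) φ = ∑ q, φ (x * i (s q)) := by
  let j : Q → G ⧸ r.ker.map i := fun q => ↑(x * i (s q))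
  have hj : Function.Injective j := by
    intro q q' hqq
    have hmem : i ((s q)⁻¹ * s q') ∈ r.ker.map i := by
      simpa [mul_assoc] using QuotientGroup.eq.mp hqq
    rw [Subgroup.mem_map_iff_mem h.injective, MonoidHom.mem_ker, map_mul, map_inv, hs,
      hs, inv_mul_eq_one] at hmem
    exact hmem
  have hcs : HasCompactSupport φ := .intro (h.isCompact_range.smul x) fun g hg =>
    hx g fun h => hg ⟨x⁻¹ * g, h, by simp⟩
  have hsupp : (Function.support fun y : G ⧸ r.ker.map i => φ y.out) ⊆
      ↑(Finset.univ.map ⟨j, hj⟩) := by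
    intro y hy
    obtain ⟨k, hk⟩ := not_imp_comm.mp (hx y.out) hy
    refine Finset.mem_coe.mpr (Finset.mem_map.mpr ⟨r k, Finset.mem_univ _, ?_⟩)
    rw [← y.out_eq']
    refine QuotientGroup.eq.mpr ⟨(s (r k))⁻¹ * k, ?_, ?_⟩
    · simp [hs]
    · rw [map_mul, hk, map_inv, mul_inv_rev, mul_assoc]
  rw [haarIntegral_of_mul_right_eq h₀ hcs hφ, finsum_eq_sum_of_support_subset _ hsupp,
    Finset.sum_map]
  exact Finset.sum_congr rfl fun q _ => apply_out_of_mul_right_eq hφ _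

theorem act_inflate_of_fixed (h : IsReduction i r) (h₀ : IsNormalizing R (r.ker.map i))
    (hs : ∀ q, r (s q) = q) (hv : ∀ u ∈ r.ker.map i, ρ u v = v) :
    act R (r.ker.map i) ρ (inflate i r c) v = ∑ q, c q • ρ (i (s q)) v := by
  rw [act, haarIntegral_eq_sum h h₀ hs 1]
  · simp [inflate_apply h.injective, hs]
  · intro g u hu
    rw [inflate_mul_right_ker h.injective g u hu, map_mul, Module.End.mul_apply, hv u hu]
  · intro g hg
    rw [inflate_of_notMem_range (by simpa using hg), zero_smul]

/-- The element `∑ c(q) q` of the group algebra of `Q` annihilates the representation induced from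
the trivial representation of `B`. The latter is modelled by the right `B`-invariant functions, on
which `Q` acts by left translation. -/
def AnnihilatesInduced (B : Subgroup Q) (c : Q → R) : Prop :=
  ∀ φ : Q → R, (∀ g, ∀ b ∈ B, φ (g * b) = φ g) → ∀ y, ∑ q, c q * φ (q⁻¹ * y) = 0

theorem sum_smul_compactInd_eq_zero (hs : ∀ q, r (s q) = q)
    (hH : ∀ x, ∃ y, ∀ b ∈ B, ∃ k, r k = y * b * y⁻¹ ∧ x⁻¹ * i k * x ∈ H)
    (hc : AnnihilatesInduced B c) {w : CompactInd R H}
    (hw : ∀ u ∈ r.ker.map i, compactInd R H u w = w) :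
    ∑ q, c q • compactInd R H (i (s q)) w = 0 := by
  have hw' : ∀ k k' x, r k = r k' → w.1 (i k * x) = w.1 (i k' * x) := by
    intro k k' x hk
    have hfix := hw (i (k * k'⁻¹)) ⟨_, by simp [hk], rfl⟩
    simpa [compactInd, mul_assoc] using (congrFun (congrArg Subtype.val hfix) (i k * x)).symm
  refine Subtype.ext (funext fun x => ?_)
  obtain ⟨y, hy⟩ := hH x
  let φ : Q → R := fun q => w.1 (i (s (q * y⁻¹)) * x)
  have hφ : ∀ q, ∀ b ∈ B, φ (q * b) = φ q := by
    intro q b hb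
    obtain ⟨k, hk, hkH⟩ := hy b hb
    refine .trans ?_ (w.2.1 (i (s (q * y⁻¹)) * x) _ hkH)
    simp only [φ, mul_assoc, mul_inv_cancel_left]
    rw [← mul_assoc (i _) (i k) x, ← map_mul]
    exact hw' _ _ x (by simp [hs, hk, mul_assoc])
  have hφy : ∀ q, φ (q⁻¹ * y) = w.1 ((i (s q))⁻¹ * x) := by
    intro q
    simp only [φ, mul_inv_cancel_right, ← map_inv i]
    exact hw' _ _ x (by simp [hs])
  simpa [compactInd, hφy] using hc φ hφ y

theorem act_inflate_eq_zero (h : IsReduction i r) (h₀ : IsNormalizing R (r.ker.map i))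
    (hH : ∀ x, ∃ y, ∀ b ∈ B, ∃ k, r k = y * b * y⁻¹ ∧ x⁻¹ * i k * x ∈ H)
    (hc : AnnihilatesInduced B c) (v : CompactInd R H) :
    act R (r.ker.map i) (compactInd R H) (inflate i r c) v = 0 := by
  have hs := Function.surjInv_eq h.surjective
  have hv := isSmooth_compactInd H v
  have hfix := fun u (hu : u ∈ r.ker.map i) => apply_act_indicator h₀ h.isCompact_ker hv hu
  rw [← convolution_indicator_right h₀ h.isCompact_ker (inflate_mul_right_ker h.injective),
    act_convolution h₀ hv (inflate_mem_heckeSubmodule h c)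
      (indicator_mem_heckeSubmodule h₀.isOpen h.isCompact_ker),
    act_inflate_of_fixed h h₀ hs hfix, sum_smul_compactInd_eq_zero hs hH hc hfix]

theorem AnnihilatesInduced.of_act_eq_zero (h : IsReduction i r)
    (h₀ : IsNormalizing R (r.ker.map i)) (hs : ∀ q, r (s q) = q) (hf : f ∈ heckeSubmodule R G)
    (hfinv : ∀ g, ∀ u ∈ r.ker.map i, f (g * u) = f g)
    (hact : ∀ v, act R (r.ker.map i) (compactInd R ((B.comap r).map i)) f v = 0) (x : G) :
    AnnihilatesInduced B fun q => f (x * i (s q)) := by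
  intro φ hφ y
  let Φ : CompactInd R ((B.comap r).map i) := ⟨_, inflate_mem_compactInd h hφ⟩
  have heval : haarIntegral R (r.ker.map i)
      (fun g => f g * inflate i r φ (g⁻¹ * (x * i (s y)))) = 0 := by
    refine (haarIntegral_map h₀ (smul_mem_testFunctions hf (isSmooth_compactInd _ Φ))
      (LinearMap.proj (x * i (s y)) ∘ₗ (CompactInd R ((B.comap r).map i)).subtype)).trans ?_
    rw [← act, hact, map_zero]
  rw [haarIntegral_eq_sum h h₀ hs x] at heval
  · refine .trans (Finset.sum_congr rfl fun q _ => ?_) heval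
    rw [mul_inv_rev, mul_assoc, inv_mul_cancel_left, ← map_inv, ← map_mul,
      inflate_apply h.injective, map_mul, map_inv, hs, hs]
  · intro g u hu
    rw [hfinv g u hu, mul_inv_rev, mul_assoc, inflate_mul_left_ker h.injective _ _ (inv_mem hu)]
  · intro g hg
    rw [inflate_of_notMem_range, mul_zero]
    rw [← mul_assoc, i.range.mul_mem_cancel_right ⟨_, rfl⟩, ← i.range.inv_mem_iff]
    simpa using hg

end Reduction

section FiniteGroup

variable {R : Type*} [Field R] {Q : Type*} [Group Q] {B : Subgroup Q}

theorem annihilator_ind_eq_annihilator_coind [B.FiniteIndex] (A : Rep R B) :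
    Module.annihilator (MonoidAlgebra R Q) (A.ρ.ind B.subtype).asModule =
      Module.annihilator (MonoidAlgebra R Q) (A.ρ.coind B.subtype).asModule := by
  classical
  have hmk : ∀ g a x, (A.indToCoind (Representation.IndV.mk B.subtype A.ρ g a)).1 x =
      A.indToCoindAux g a x := fun g a x => by
    simp only [LinearMap.comp_apply, TensorProduct.mk_apply, Representation.Coinvariants.lift_mk,
      TensorProduct.lift.tmul, LinearEquiv.coe_coe, MonoidAlgebra.coeffLinearEquiv_apply,
      MonoidAlgebra.coeff_single, Finsupp.linearCombination_single, one_smul]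
    rfl
  have hequiv : ∀ q, A.indToCoind ∘ₗ A.ρ.ind B.subtype q =
      A.ρ.coind B.subtype q ∘ₗ A.indToCoind := fun q =>
    Representation.IndV.hom_ext _ _ fun g => LinearMap.ext fun a => Subtype.ext <| funext fun x =>
      calc (A.indToCoind (A.ρ.ind B.subtype q (Representation.IndV.mk B.subtype A.ρ g a))).1 x
        _ = A.indToCoindAux (g * q⁻¹) a x := by rw [Representation.ind_mk, hmk]
        _ = A.indToCoindAux g a (x * q) := Rep.indToCoindAux_fst_mul_inv ..
        _ = (A.ρ.coind B.subtype q (A.indToCoind (Representation.IndV.mk _ _ g a))).1 x :=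
          (hmk g a (x * q)).symm
  let e : (A.ρ.ind B.subtype).asModule →ₗ[MonoidAlgebra R Q] (A.ρ.coind B.subtype).asModule :=
    Representation.IntertwiningMap.equivLinearMapAsModule _ _
      ⟨A.indToCoind, hequiv⟩
  have he : Function.Bijective e := Function.bijective_iff_has_inverse.mpr
    ⟨A.coindToInd, LinearMap.congr_fun A.indToCoind_coindToInd,
      LinearMap.congr_fun A.coindToInd_indToCoind⟩
  exact (LinearEquiv.ofBijective e he).annihilator_eq

variable [Fintype Q] {z : MonoidAlgebra R Q}

theorem mem_annihilator_asModule_iff {V : Type*} [AddCommGroup V] [Module R V]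
    (ρ : Representation R Q V) :
    z ∈ Module.annihilator (MonoidAlgebra R Q) ρ.asModule ↔
      ∀ v, ∑ q, z.coeff q • ρ q v = 0 := by
  have hact : ∀ v, ρ.asAlgebraHom z v = ∑ q, z.coeff q • ρ q v := fun v => by
    rw [Representation.asAlgebraHom_def, MonoidAlgebra.lift_apply,
      Finsupp.sum_fintype _ _ (by simp)]
    simp
  simp only [← hact, Module.mem_annihilator]
  exact ρ.asModuleEquiv.forall_congr fun {v} => by
    rw [← ρ.asModuleEquiv.map_eq_zero_iff, Representation.asModuleEquiv_map_smul]
    rfl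

theorem mem_annihilator_ind_trivial_iff :
    z ∈ Module.annihilator (MonoidAlgebra R Q)
      (Representation.ind B.subtype (Representation.trivial R B R)).asModule ↔
    AnnihilatesInduced B z.coeff := by
  have h := annihilator_ind_eq_annihilator_coind (Rep.of (Representation.trivial R B R))
  rw [show Module.annihilator _ _ = _ from h, mem_annihilator_asModule_iff]
  have hsum : ∀ (f : Representation.coindV B.subtype (Representation.trivial R B R)) y,
      (∑ q, z.coeff q • Representation.coind B.subtype _ q f).1 y =
        ∑ q, z.coeff q * f.1 (y * q) := fun f y => by
    rw [Submodule.coe_sum, Finset.sum_apply]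
    rfl
  constructor
  · intro hz φ hφ y
    have hinv : (fun q => φ q⁻¹) ∈
        Representation.coindV B.subtype (Representation.trivial R B R) := fun b q => by
      simpa using hφ q⁻¹ _ (B.inv_mem b.2)
    simpa using (hsum ⟨_, hinv⟩ y⁻¹).symm.trans (congrFun (congrArg Subtype.val (hz _)) _)
  · intro hz f
    have hinv : ∀ q, ∀ b ∈ B, f.1 (q * b)⁻¹ = f.1 q⁻¹ := fun q b hb => by
      simpa using f.2 ⟨b⁻¹, B.inv_mem hb⟩ q⁻¹
    refine Subtype.ext (funext fun y => (hsum f y).trans ?_)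
    simpa using hz (fun q => f.1 q⁻¹) hinv y⁻¹

end FiniteGroup

section IntegralPoints

theorem isOpen_setOf_forall_apply_mem {X Y ι : Type*} [TopologicalSpace X] [TopologicalSpace Y]
    [Finite ι] {φ : X → Matrix ι ι Y} (hφ : Continuous φ) {S : Set Y} (hS : IsOpen S) :
    IsOpen {x | ∀ i j, φ x i j ∈ S} := by
  simp only [Set.ofPred_forall]
  exact isOpen_iInter_of_finite fun i => isOpen_iInter_of_finite fun j =>
    hS.preimage (hφ.matrix_elem i j)

variable {F : Type*} [Field F] [ValuativeRel F] {n : ℕ}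

theorem incl_apply (k : Matrix.GeneralLinearGroup (Fin n) 𝒪[F]) (i j : Fin n) :
    (incl F n k).1 i j = k i j := rfl

theorem coe_sub_one_apply (k : Matrix.GeneralLinearGroup (Fin n) 𝒪[F]) (i j : Fin n) :
    (((k.1 - 1) i j : 𝒪[F]) : F) = ((incl F n k).1 - 1) i j := by
  rw [Matrix.sub_apply, Matrix.sub_apply, incl_apply, Matrix.one_apply, Matrix.one_apply]
  split_ifs <;> simp

variable (F n) in
theorem mapMatrix_algebraMap_injective :
    Function.Injective ((algebraMap 𝒪[F] F).mapMatrix (m := Fin n)) :=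
  Matrix.map_injective Subtype.val_injective

theorem incl_injective : Function.Injective (incl F n) :=
  Units.map_injective (mapMatrix_algebraMap_injective F n)

theorem mem_maxCompact_iff {g : GLF F n} :
    g ∈ maxCompact F n ↔ (∀ i j, g.1 i j ∈ 𝒪[F]) ∧ ∀ i j, g⁻¹.1 i j ∈ 𝒪[F] := by
  constructor
  · rintro ⟨k, rfl⟩
    exact ⟨fun i j => (k i j).2, fun i j => (k⁻¹.1 i j).2⟩
  · rintro ⟨hg, hg'⟩
    let A : Matrix (Fin n) (Fin n) 𝒪[F] := Matrix.of fun i j => ⟨_, hg i j⟩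
    let B : Matrix (Fin n) (Fin n) 𝒪[F] := Matrix.of fun i j => ⟨_, hg' i j⟩
    have hAB : A * B = 1 := mapMatrix_algebraMap_injective F n <| by
      rw [map_mul, map_one]
      exact g.mul_inv
    have hBA : B * A = 1 := mapMatrix_algebraMap_injective F n <| by
      rw [map_mul, map_one]
      exact g.inv_mul
    exact ⟨⟨A, B, hAB, hBA⟩, rfl⟩

variable [TopologicalSpace F] [IsNonarchimedeanLocalField F]

theorem red_apply (k : Matrix.GeneralLinearGroup (Fin n) 𝒪[F]) (i j : Fin n) :
    (red F n k).1 i j = IsLocalRing.residue 𝒪[F] (k i j) := rfl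

theorem residue_eq_zero_iff_valuation_lt_one {x : 𝒪[F]} :
    IsLocalRing.residue 𝒪[F] x = 0 ↔ ValuativeRel.valuation F (x : F) < 1 := by
  rw [IsLocalRing.residue_eq_zero_iff]
  exact Valuation.mem_maximalIdeal_iff (v := ValuativeRel.valuation F) (a := x)

theorem red_eq_one_iff {k : Matrix.GeneralLinearGroup (Fin n) 𝒪[F]} :
    red F n k = 1 ↔ ∀ i j, (k.1 - 1) i j ∈ 𝓂[F] := by
  simp_rw [← IsLocalRing.residue_eq_zero_iff, Matrix.sub_apply, map_sub, sub_eq_zero,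
    Units.ext_iff, ← Matrix.ext_iff, red_apply, Units.val_one, Matrix.one_apply, apply_ite,
    map_one, map_zero]

theorem mem_proRadical_iff {g : GLF F n} :
    g ∈ proRadical F n ↔
      g ∈ maxCompact F n ∧ ∀ i j, ValuativeRel.valuation F ((g.1 - 1) i j) < 1 := by
  have key (k : Matrix.GeneralLinearGroup (Fin n) 𝒪[F]) :
      k ∈ (red F n).ker ↔ ∀ i j, ValuativeRel.valuation F (((incl F n k).1 - 1) i j) < 1 := by
    rw [MonoidHom.mem_ker, red_eq_one_iff]
    refine forall₂_congr fun i j => ?_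
    rw [← IsLocalRing.residue_eq_zero_iff, residue_eq_zero_iff_valuation_lt_one,
      coe_sub_one_apply]
  constructor
  · rintro ⟨k, hk, rfl⟩
    exact ⟨⟨k, rfl⟩, (key k).mp hk⟩
  · rintro ⟨⟨k, rfl⟩, h⟩
    exact ⟨k, (key k).mpr h, rfl⟩

theorem isOpen_proRadical : IsOpen (proRadical F n : Set (GLF F n)) := by
  have hball : IsOpen {x : F | ValuativeRel.valuation F x < 1} := by
    simpa only [Valuation.restrict_lt_one_iff] using
      Valuation.isOpen_ball (v := ValuativeRel.valuation F) 1
  have hset : (proRadical F n : Set (GLF F n)) = ({g | ∀ i j, g.1 i j ∈ 𝒪[F]} ∩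
      {g | ∀ i j, g⁻¹.1 i j ∈ 𝒪[F]}) ∩
      {g | ∀ i j, (g.1 - 1) i j ∈ {x : F | ValuativeRel.valuation F x < 1}} := by
    ext g
    exact mem_proRadical_iff.trans (and_congr_left' mem_maxCompact_iff)
  rw [hset]
  exact ((isOpen_setOf_forall_apply_mem Units.continuous_val Valuation.isOpen_integer).inter
    (isOpen_setOf_forall_apply_mem (Units.continuous_val.comp continuous_inv)
      Valuation.isOpen_integer)).inter
    (isOpen_setOf_forall_apply_mem (Units.continuous_val.sub continuous_const) hball)

theorem isCompact_maxCompact : IsCompact (maxCompact F n : Set (GLF F n)) := by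
  have : T2Space F := by
    let _ := IsTopologicalAddGroup.rightUniformSpace F
    have := isUniformAddGroup_of_addCommGroup (G := F)
    infer_instance
  have : CompactSpace (Matrix (Fin n) (Fin n) 𝒪[F]) :=
    inferInstanceAs (CompactSpace (Fin n → Fin n → 𝒪[F]))
  have : CompactSpace (Matrix.GeneralLinearGroup (Fin n) 𝒪[F]) :=
    inferInstanceAs (CompactSpace (Matrix (Fin n) (Fin n) 𝒪[F])ˣ)
  have hincl : Continuous (incl F n) := Continuous.units_map _ <| continuous_matrix fun i j =>
    continuous_subtype_val.comp (continuous_apply_apply i j)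
  exact isCompact_range hincl

variable (F n) in
theorem isReduction : IsReduction (incl F n) (red F n) where
  injective := incl_injective
  surjective := red_surjective F n
  isOpen_ker := isOpen_proRadical
  isCompact_range := isCompact_maxCompact

end IntegralPoints

section ProP

theorem index_eq_prime_pow_of_tendsto {G : Type*} [Group G] [TopologicalSpace G]
    [IsTopologicalGroup G] [CompactSpace G] {p : ℕ} (hp : p.Prime)
    (hG : ∀ g : G, Filter.Tendsto (fun m : ℕ => g ^ p ^ m) Filter.atTop (nhds 1))
    {U : Subgroup G} (hU : IsOpen (U : Set G)) : ∃ k, U.index = p ^ k := by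
  have : Finite (G ⧸ U) := U.quotient_finite_of_isOpen hU
  have : U.FiniteIndex := U.finiteIndex_of_finite_quotient
  have hcore : IsOpen (U.normalCore : Set G) := U.normalCore.isOpen_of_isClosed_of_finiteIndex
    (U.normalCore_isClosed (U.isClosed_of_isOpen hU))
  have : Fact p.Prime := ⟨hp⟩
  have hquot : IsPGroup p (G ⧸ U.normalCore) := by
    intro x
    obtain ⟨g, rfl⟩ := QuotientGroup.mk_surjective x
    obtain ⟨m, hm⟩ := ((hG g).eventually (hcore.mem_nhds U.normalCore.one_mem)).exists
    exact ⟨m, (QuotientGroup.eq_one_iff _).mpr hm⟩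
  obtain ⟨k, hk⟩ := hquot.exists_card_eq
  have hdvd : U.index ∣ p ^ k := hk ▸ Subgroup.index_dvd_of_le U.normalCore_le
  obtain ⟨m, -, hm⟩ := (Nat.dvd_prime_pow hp).mp hdvd
  exact ⟨m, hm⟩

theorem mul_apply_mem_mul {A : Type*} [CommRing A] {ι : Type*} [Fintype ι] {I J : Ideal A}
    {X Y : Matrix ι ι A} (hX : ∀ i j, X i j ∈ I) (hY : ∀ i j, Y i j ∈ J) (i j : ι) :
    (X * Y) i j ∈ I * J :=
  Ideal.sum_mem _ fun k _ => Ideal.mul_mem_mul (hX i k) (hY k j)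

theorem pow_prime_pow_sub_one_apply_mem {A : Type*} [CommRing A] {ι : Type*} [Fintype ι]
    [DecidableEq ι] {I : Ideal A} {p : ℕ} (hp : p.Prime) (hpI : (p : A) ∈ I) {X : Matrix ι ι A}
    (hX : ∀ i j, (X - 1) i j ∈ I) (m : ℕ) (i j : ι) : (X ^ p ^ m - 1) i j ∈ I ^ (m + 1) := by
  induction m generalizing i j with
  | zero => simpa only [pow_zero, pow_one, zero_add] using hX i j
  | succ m ih =>
    set Y := X ^ p ^ m - 1 with hY
    obtain ⟨Z, hZ⟩ := (Commute.one_right Y).exists_add_pow_prime_eq hp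
    have hpow : X ^ p ^ (m + 1) - 1 = Y * Y * Y ^ (p - 2) + p • (Y * Z) := by
      rw [← pow_two, ← pow_add, Nat.add_sub_of_le hp.two_le, pow_succ, pow_mul,
        ← sub_add_cancel (X ^ p ^ m) 1, ← hY, hZ, one_pow, mul_one, nsmul_eq_mul, mul_assoc]
      abel
    have hmul {Y' : Matrix ι ι A} {J : Ideal A} (hY' : ∀ i j, Y' i j ∈ J) (Z : Matrix ι ι A) :
        (Y' * Z) i j ∈ J := by
      simpa only [Ideal.mul_top] using mul_apply_mem_mul hY' (Y := Z) (J := ⊤)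
        (fun _ _ => Submodule.mem_top) i j
    have hsq (i j) : (Y * Y) i j ∈ I ^ (m + 1 + 1) := by
      rw [pow_succ]
      exact Ideal.mul_mono_right (Ideal.pow_le_self m.succ_ne_zero) (mul_apply_mem_mul ih ih i j)
    rw [hpow, Matrix.add_apply, Matrix.smul_apply, nsmul_eq_mul, pow_succ']
    exact Ideal.add_mem _ (pow_succ' I (m + 1) ▸ hmul hsq _) (Ideal.mul_mem_mul hpI (hmul ih Z))

variable {F : Type*} [Field F] [ValuativeRel F] [TopologicalSpace F] [IsNonarchimedeanLocalField F]
  {n p : ℕ}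

theorem tendsto_zero_of_mem_maximalIdeal_pow {a : ℕ → 𝒪[F]} (ha : ∀ m, a m ∈ 𝓂[F] ^ m) :
    Filter.Tendsto (fun m => (a m : F)) Filter.atTop (nhds 0) := by
  obtain ⟨ϖ, hϖ⟩ := IsDiscreteValuationRing.exists_irreducible 𝒪[F]
  have hlt : ValuativeRel.valuation F (ϖ : F) < 1 := by
    rw [← residue_eq_zero_iff_valuation_lt_one, IsLocalRing.residue_eq_zero_iff]
    exact hϖ.not_isUnit
  have : MulArchimedean (ValuativeRel.ValueGroupWithZero F) :=
    ValuativeRel.isRankLeOne_iff_mulArchimedean.mp inferInstance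
  rw [(IsValuativeTopology.hasBasis_nhds_zero F).tendsto_right_iff]
  intro γ _
  obtain ⟨N, hN⟩ := exists_pow_lt₀ hlt γ
  filter_upwards [Filter.eventually_ge_atTop N] with m hm
  have hdvd : ϖ ^ N ∣ a m := by
    have := Ideal.pow_le_pow_right hm (ha m)
    rwa [hϖ.maximalIdeal_eq, Ideal.span_singleton_pow, Ideal.mem_span_singleton] at this
  obtain ⟨b, hb⟩ := hdvd
  calc ValuativeRel.valuation F (a m : F)
      = ValuativeRel.valuation F ϖ ^ N * ValuativeRel.valuation F b := by
        rw [hb, Subring.coe_mul, Subring.coe_pow, map_mul, map_pow]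
    _ ≤ ValuativeRel.valuation F ϖ ^ N := mul_le_of_le_one_right' b.2
    _ < γ := hN

variable [CharP 𝓀[F] p]

variable (F p) in
theorem natCast_mem_maximalIdeal : (p : 𝒪[F]) ∈ 𝓂[F] := by
  rw [← IsLocalRing.residue_eq_zero_iff, map_natCast, CharP.cast_eq_zero]

theorem tendsto_val_pow_prime_pow {g : GLF F n} (hg : g ∈ proRadical F n) :
    Filter.Tendsto (fun m : ℕ => (g ^ p ^ m).1) Filter.atTop (nhds 1) := by
  obtain ⟨k, hk, rfl⟩ := hg
  have hk' := red_eq_one_iff.mp hk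
  refine tendsto_pi_nhds.mpr fun i => tendsto_pi_nhds.mpr fun j => ?_
  have hsub : Filter.Tendsto (fun m : ℕ => (((k.1 ^ p ^ m - 1) i j : 𝒪[F]) : F))
      Filter.atTop (nhds 0) := tendsto_zero_of_mem_maximalIdeal_pow fun m =>
    Ideal.pow_le_pow_right m.le_succ (pow_prime_pow_sub_one_apply_mem
      (CharP.char_is_prime 𝓀[F] p) (natCast_mem_maximalIdeal F p) hk' m i j)
  have hadd := hsub.add_const ((1 : Matrix (Fin n) (Fin n) F) i j)
  rw [zero_add] at hadd
  refine hadd.congr fun m => ?_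
  rw [← Units.val_pow_eq_pow_val, coe_sub_one_apply, map_pow, Matrix.sub_apply, sub_add_cancel]

theorem tendsto_pow_prime_pow {g : GLF F n} (hg : g ∈ proRadical F n) :
    Filter.Tendsto (fun m : ℕ => g ^ p ^ m) Filter.atTop (nhds 1) := by
  rw [Units.isEmbedding_embedProduct.tendsto_nhds_iff]
  refine (tendsto_val_pow_prime_pow hg).prodMk_nhds
    ((MulOpposite.continuous_op.tendsto _).comp ?_)
  simpa only [inv_pow, Function.comp_def, inv_one, Units.val_one] using
    tendsto_val_pow_prime_pow (inv_mem hg)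

theorem isNormalizing_proRadical {R : Type*} [Field R] (hp : (p : R) ≠ 0) :
    IsNormalizing R (proRadical F n) where
  isOpen := isOpen_proRadical
  relIndex_ne_zero U hU _ := by
    have : CompactSpace (proRadical F n) := isCompact_iff_compactSpace.mp
      (isReduction F n).isCompact_ker
    have htendsto (g : proRadical F n) :
        Filter.Tendsto (fun m : ℕ => g ^ p ^ m) Filter.atTop (nhds 1) :=
      tendsto_subtype_rng.mpr (tendsto_pow_prime_pow g.2)
    obtain ⟨k, hk⟩ := index_eq_prime_pow_of_tendsto (CharP.char_is_prime 𝓀[F] p) htendsto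
      (U := U.subgroupOf (proRadical F n)) (hU.preimage continuous_subtype_val)
    rw [Subgroup.relIndex, hk, Nat.cast_pow]
    exact pow_ne_zero k hp

end ProP

section Elimination

section Unipotent

variable {A : Type*} [CommRing A] {ι : Type*} [Fintype ι] {u v : ι → A}

theorem vecMulVec_mul_self (h : v ⬝ᵥ u = 0) :
    Matrix.vecMulVec u v * Matrix.vecMulVec u v = 0 := by
  rw [Matrix.vecMulVec_mul_vecMulVec, h, zero_smul, Matrix.vecMulVec_zero]

variable [DecidableEq ι]

/-- The transvection `1 - u vᵀ`, where `v ⬝ᵥ u = 0`. With `u` or `v` a basis vector it clears a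
whole column or row at once in Gaussian elimination. -/
def unipotent (u v : ι → A) (h : v ⬝ᵥ u = 0) : Matrix.GeneralLinearGroup ι A where
  val := 1 - Matrix.vecMulVec u v
  inv := 1 + Matrix.vecMulVec u v
  val_inv := by
    rw [sub_mul, mul_add, mul_add, vecMulVec_mul_self h]
    simp
  inv_val := by
    rw [add_mul, mul_sub, mul_sub, vecMulVec_mul_self h]
    simp

theorem unipotent_mul_mul_unipotent_apply (x : Matrix.GeneralLinearGroup ι A) {i j : ι}
    {c r : ι → A} (hc : Pi.single i 1 ⬝ᵥ c = 0) (hr : r ⬝ᵥ Pi.single j 1 = 0) (a b : ι) :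
    (unipotent c (Pi.single i 1) hc * x * unipotent (Pi.single j 1) r hr).1 a b =
      x.1 a b - c a * x.1 i b - (x.1 a j - c a * x.1 i j) * r b := by
  change ((1 - Matrix.vecMulVec c (Pi.single i 1)) * x.1 *
    (1 - Matrix.vecMulVec (Pi.single j 1) r)) a b = _
  rw [sub_mul, one_mul, Matrix.vecMulVec_mul, Matrix.single_one_vecMul, mul_sub, mul_one,
    Matrix.mul_vecMulVec, Matrix.mulVec_single_one]
  rfl

end Unipotent

section Pivot

variable {F : Type*} [Field F] {ι : Type*} {X : Matrix ι ι F} {i j i' j' : ι}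

/-- The entry of `X` at `(i, j)` is the only nonzero entry in its row and in its column. -/
def IsPivot (X : Matrix ι ι F) (i j : ι) : Prop :=
  X i j ≠ 0 ∧ (∀ i', i' ≠ i → X i' j = 0) ∧ ∀ j', j' ≠ j → X i j' = 0

variable [DecidableEq ι]

/-- The multiples of row `i` to subtract from the other rows in order to clear column `j`. -/
def colMultipliers (X : Matrix ι ι F) (i j : ι) : ι → F :=
  Function.update (fun a => X a j / X i j) i 0

/-- The multiples of column `j` to subtract from the other columns in order to clear row `i`. -/
def rowMultipliers (X : Matrix ι ι F) (i j : ι) : ι → F :=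
  Function.update (fun b => X i b / X i j) j 0

/-- The result of clearing column `j` by row operations and then row `i` by column operations. -/
def eliminate (X : Matrix ι ι F) (i j : ι) : Matrix ι ι F := Matrix.of fun a b =>
  X a b - colMultipliers X i j a * X i b -
    (X a j - colMultipliers X i j a * X i j) * rowMultipliers X i j b

theorem isPivot_eliminate (hij : X i j ≠ 0) : IsPivot (eliminate X i j) i j := by
  refine ⟨?_, fun a ha => ?_, fun b hb => ?_⟩
  · simpa [eliminate, colMultipliers, rowMultipliers] using hij
  · simp [eliminate, colMultipliers, rowMultipliers, ha, hij]
  · simp [eliminate, colMultipliers, rowMultipliers, hb, hij, mul_div_cancel₀]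

theorem IsPivot.eliminate (h : IsPivot X i' j') (hj : j' ≠ j) (hij : X i j ≠ 0) :
    IsPivot (eliminate X i j) i' j' := by
  obtain ⟨hne, hcol, hrow⟩ := h
  have hi : i' ≠ i := by
    rintro rfl
    exact hij (hrow j hj.symm)
  have hc : colMultipliers X i j i' = 0 := by simp [colMultipliers, hi, hrow j hj.symm]
  have hr : rowMultipliers X i j j' = 0 := by simp [rowMultipliers, hj, hcol i hi.symm]
  refine ⟨?_, fun a ha => ?_, fun b hb => ?_⟩
  · simpa [Hecke.eliminate, hc, hr] using hne
  · simp [Hecke.eliminate, hr, hcol i hi.symm, hcol a ha]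
  · simp [Hecke.eliminate, hc, hrow b hb, hrow j hj.symm]

theorem exists_mul_eq_eliminate [Fintype ι] (x : Matrix.GeneralLinearGroup ι F) (i j : ι) :
    ∃ hc hr, (unipotent (colMultipliers x.1 i j) (Pi.single i 1) hc * x *
      unipotent (Pi.single j 1) (rowMultipliers x.1 i j) hr).1 = eliminate x.1 i j := by
  refine ⟨?_, ?_, Matrix.ext fun a b => unipotent_mul_mul_unipotent_apply x _ _ a b⟩
  · rw [single_one_dotProduct, colMultipliers, Function.update_self]
  · rw [dotProduct_single_one, rowMultipliers, Function.update_self]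

theorem exists_max_entry {Γ₀ : Type*} [LinearOrderedCommGroupWithZero Γ₀] (v : Valuation F Γ₀)
    {n : ℕ} (x : Matrix.GeneralLinearGroup (Fin n) F) {S : Finset (Fin n)} (hS : S.Nonempty) :
    ∃ i, ∃ j ∈ S, x.1 i j ≠ 0 ∧
      ∀ a, ∀ b ∈ S, v (x.1 a b) ≤ v (x.1 i j) ∧ (b < j → v (x.1 a b) < v (x.1 i j)) := by
  obtain ⟨j₀, hj₀⟩ := hS
  obtain ⟨⟨i, j⟩, hj, hmax⟩ := (Finset.univ ×ˢ S).exists_max_image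
    (fun q => toLex (v (x.1 q.1 q.2), OrderDual.toDual q.2))
    ⟨(j₀, j₀), Finset.mem_product.mpr ⟨Finset.mem_univ _, hj₀⟩⟩
  have hle (a b) (hb : b ∈ S) :
      v (x.1 a b) ≤ v (x.1 i j) ∧ (b < j → v (x.1 a b) < v (x.1 i j)) := by
    have := hmax (a, b) (Finset.mem_product.mpr ⟨Finset.mem_univ _, hb⟩)
    rcases Prod.Lex.toLex_le_toLex.mp this with hlt | ⟨heq, hjb⟩
    · exact ⟨hlt.le, fun _ => hlt⟩
    · exact ⟨heq.le, fun hbj => absurd hbj (OrderDual.toDual_le_toDual.mp hjb).not_gt⟩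
  refine ⟨i, j, (Finset.mem_product.mp hj).2, fun hzero => ?_, hle⟩
  have hcol (a) : x.1 a j₀ = 0 := by
    have := (hle a j₀ hj₀).1
    rwa [hzero, map_zero, nonpos_iff_eq_zero, map_eq_zero] at this
  exact ((Matrix.isUnit_iff_isUnit_det _).mp x.isUnit).ne_zero
    (x.1.det_eq_zero_of_column_eq_zero j₀ hcol)

end Pivot

section Integral

variable {F : Type*} [Field F] [ValuativeRel F] {n : ℕ}

theorem unipotent_mem_maxCompact {u v : Fin n → F} (h : v ⬝ᵥ u = 0) (hu : ∀ i, u i ∈ 𝒪[F])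
    (hv : ∀ i, v i ∈ 𝒪[F]) : unipotent u v h ∈ maxCompact F n := by
  have hone (i j) : (1 : Matrix (Fin n) (Fin n) F) i j ∈ 𝒪[F] := by
    rw [Matrix.one_apply]
    split_ifs
    exacts [one_mem _, zero_mem _]
  exact mem_maxCompact_iff.mpr ⟨fun i j => sub_mem (hone i j) (mul_mem (hu i) (hv j)),
    fun i j => add_mem (hone i j) (mul_mem (hu i) (hv j))⟩

theorem single_one_mem (i j : Fin n) : (Pi.single i 1 : Fin n → F) j ∈ 𝒪[F] := by
  rw [Pi.single_apply]
  split_ifs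
  exacts [one_mem _, zero_mem _]

variable [TopologicalSpace F] [IsNonarchimedeanLocalField F]

theorem mem_iwahori_iff {g : GLF F n} :
    g ∈ iwahori F n ↔
      g ∈ maxCompact F n ∧ ∀ i j, j < i → ValuativeRel.valuation F (g.1 i j) < 1 := by
  have key (k : Matrix.GeneralLinearGroup (Fin n) 𝒪[F]) : red F n k ∈ borel F n ↔
      ∀ i j, j < i → ValuativeRel.valuation F ((incl F n k).1 i j) < 1 :=
    forall₃_congr fun i j _ => by
      rw [red_apply, residue_eq_zero_iff_valuation_lt_one, incl_apply]
  constructor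
  · rintro ⟨k, hk, rfl⟩
    exact ⟨⟨k, rfl⟩, (key k).mp hk⟩
  · rintro ⟨⟨k, rfl⟩, h⟩
    exact ⟨k, (key k).mpr h, rfl⟩

theorem exists_mul_mul_val_eq_eliminate {x : GLF F n} {i j : Fin n} (hij : x.1 i j ≠ 0)
    (hcol : ∀ a, ValuativeRel.valuation F (x.1 a j) ≤ ValuativeRel.valuation F (x.1 i j))
    (hrow : ∀ b, ValuativeRel.valuation F (x.1 i b) ≤ ValuativeRel.valuation F (x.1 i j))
    (hlt : ∀ b < j, ValuativeRel.valuation F (x.1 i b) < ValuativeRel.valuation F (x.1 i j)) :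
    ∃ k ∈ maxCompact F n, ∃ u ∈ iwahori F n, (k * x * u).1 = eliminate x.1 i j := by
  have hpos : 0 < ValuativeRel.valuation F (x.1 i j) := by simpa [zero_lt_iff] using hij
  obtain ⟨hc, hr, h⟩ := exists_mul_eq_eliminate x i j
  refine ⟨_, unipotent_mem_maxCompact hc (fun a => ?_) (single_one_mem i), _,
    mem_iwahori_iff.mpr ⟨unipotent_mem_maxCompact hr (single_one_mem j) fun b => ?_, ?_⟩, h⟩
  · rw [colMultipliers, Function.update_apply]
    split_ifs
    · exact zero_mem _
    · rw [Valuation.mem_integer_iff, map_div₀]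
      exact (div_le_one₀ hpos).mpr (hcol a)
  · rw [rowMultipliers, Function.update_apply]
    split_ifs
    · exact zero_mem _
    · rw [Valuation.mem_integer_iff, map_div₀]
      exact (div_le_one₀ hpos).mpr (hrow b)
  · intro a b hba
    change ValuativeRel.valuation F ((1 : Matrix (Fin n) (Fin n) F) a b -
      (Pi.single j 1 : Fin n → F) a * rowMultipliers x.1 i j b) < 1
    rw [Matrix.one_apply_ne hba.ne', zero_sub, Valuation.map_neg, Pi.single_apply]
    split_ifs with ha
    · subst ha
      rw [one_mul, rowMultipliers, Function.update_of_ne hba.ne, map_div₀]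
      exact (div_lt_one₀ hpos).mpr (hlt b hba)
    · simp

theorem exists_mul_mul_isPivot (S : Finset (Fin n)) (x : GLF F n)
    (hS : ∀ j ∉ S, ∃ i, IsPivot x.1 i j) :
    ∃ k ∈ maxCompact F n, ∃ u ∈ iwahori F n, ∀ j, ∃ i, IsPivot (k * x * u).1 i j := by
  induction S using Finset.strongInduction generalizing x with
  | H S ih =>
    obtain rfl | hne := S.eq_empty_or_nonempty
    · exact ⟨1, one_mem _, 1, one_mem _, by simpa using hS⟩
    obtain ⟨i, j, hj, hij, hmax⟩ := exists_max_entry (ValuativeRel.valuation F) x hne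
    have hzero (b) (hb : b ∉ S) : x.1 i b = 0 := by
      obtain ⟨i', hi'⟩ := hS b hb
      refine hi'.2.1 i ?_
      rintro rfl
      exact hij (hi'.2.2 j (ne_of_mem_of_not_mem hj hb))
    have hpos : 0 < ValuativeRel.valuation F (x.1 i j) := by simpa [zero_lt_iff] using hij
    have hrow (b) : ValuativeRel.valuation F (x.1 i b) ≤ ValuativeRel.valuation F (x.1 i j) ∧
        (b < j → ValuativeRel.valuation F (x.1 i b) < ValuativeRel.valuation F (x.1 i j)) := by
      by_cases hb : b ∈ S
      · exact hmax i b hb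
      · simp [hzero b hb, hpos]
    obtain ⟨k, hk, u, hu, hx⟩ := exists_mul_mul_val_eq_eliminate hij
      (fun a => (hmax a j hj).1) (fun b => (hrow b).1) fun b => (hrow b).2
    obtain ⟨k', hk', u', hu', h⟩ := ih _ (Finset.erase_ssubset hj) (k * x * u) fun b hb => by
      rw [hx]
      obtain rfl | hbj := eq_or_ne b j
      · exact ⟨i, isPivot_eliminate hij⟩
      · obtain ⟨i', hi'⟩ := hS b fun hbS => hb (Finset.mem_erase.mpr ⟨hbj, hbS⟩)
        exact ⟨i', hi'.eliminate hbj hij⟩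
    exact ⟨k' * k, mul_mem hk' hk, u * u', mul_mem hu hu', by simpa only [mul_assoc] using h⟩

end Integral

end Elimination

section PermutationMatrix

variable {A : Type*} [CommRing A] {ι : Type*} [Fintype ι] [DecidableEq ι]

/-- The permutation matrix of `σ`, sending the basis vector `e j` to `e (σ j)`. -/
def permGL (A : Type*) [CommRing A] : Equiv.Perm ι →* Matrix.GeneralLinearGroup ι A :=
  Matrix.permMatrixHom.toHomUnits

theorem permGL_mul_apply (σ : Equiv.Perm ι) (M : Matrix ι ι A) (i j : ι) :
    ((permGL A σ).1 * M) i j = M (σ⁻¹ i) j :=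
  congrFun₂ (PEquiv.toMatrix_toPEquiv_mul σ⁻¹ M) i j

theorem permGL_conj_apply (σ : Equiv.Perm ι) (g : Matrix.GeneralLinearGroup ι A) (i j : ι) :
    (permGL A σ * g * (permGL A σ)⁻¹).1 i j = g.1 (σ⁻¹ i) (σ⁻¹ j) := by
  rw [← map_inv, mul_assoc, Units.val_mul, permGL_mul_apply, Units.val_mul]
  exact congrFun₂ (PEquiv.mul_toMatrix_toPEquiv g.1 σ⁻¹⁻¹) (σ⁻¹ i) j

theorem map_permGL {B : Type*} [CommRing B] (f : A →+* B) (σ : Equiv.Perm ι) :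
    Matrix.GeneralLinearGroup.map f (permGL A σ) = permGL B σ :=
  Units.ext (PEquiv.map_toMatrix f σ⁻¹.toPEquiv)

end PermutationMatrix

theorem blockTriangular_inv {A : Type*} [CommRing A] {ι : Type*} [Fintype ι] [LinearOrder ι]
    {g : Matrix.GeneralLinearGroup ι A} (hg : g.1.BlockTriangular id) :
    g⁻¹.1.BlockTriangular id := by
  let _ := g.invertible
  rw [Matrix.coe_units_inv]
  exact Matrix.blockTriangular_inv_of_blockTriangular hg

theorem inv_mul_mul_apply_of_eq_diagonal {F : Type*} [Field F] {ι : Type*} [Fintype ι]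
    [DecidableEq ι] {D : Matrix.GeneralLinearGroup ι F} {d : ι → F}
    (hD : D.1 = Matrix.diagonal d) (hd : ∀ i, d i ≠ 0) (g : Matrix.GeneralLinearGroup ι F)
    (i j : ι) : (D⁻¹ * g * D).1 i j = (d i)⁻¹ * g.1 i j * d j := by
  have hDi : D⁻¹.1 = Matrix.diagonal d⁻¹ := by
    refine Units.inv_eq_of_mul_eq_one_right ?_
    rw [hD, Matrix.diagonal_mul_diagonal]
    simp [hd]
  rw [Units.val_mul, Units.val_mul, hD, hDi, Matrix.mul_diagonal, Matrix.diagonal_mul,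
    Pi.inv_apply]

theorem exists_perm_sorted {Γ : Type*} [LinearOrder Γ] {n : ℕ} (v : Fin n → Γ) :
    ∃ τ : Equiv.Perm (Fin n), ∀ i j, τ⁻¹ i ≤ τ⁻¹ j → v j ≤ v i ∧ (j < i → v j < v i) := by
  obtain ⟨hmono, hstable⟩ := (Tuple.eq_sort_iff (f := OrderDual.toDual ∘ v)).mp rfl
  refine ⟨Tuple.sort (OrderDual.toDual ∘ v), fun i j hij => ?_⟩
  have hle : v j ≤ v i := by simpa using hmono hij
  refine ⟨hle, fun hji => hle.lt_of_ne fun heq => ?_⟩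
  have hlt := hij.lt_of_ne fun h => hji.ne' (Equiv.injective _ h)
  exact hji.not_gt (by simpa [heq] using hstable _ _ hlt)

section Cartan

variable {F : Type*} [Field F] [ValuativeRel F] [TopologicalSpace F] [IsNonarchimedeanLocalField F]
  {n : ℕ}

theorem exists_mul_mul_eq_diagonal (x : GLF F n) :
    ∃ k ∈ maxCompact F n, ∃ u ∈ iwahori F n, ∃ d : Fin n → F,
      (∀ i, d i ≠ 0) ∧ (k * x * u).1 = Matrix.diagonal d := by
  obtain ⟨k, hk, u, hu, h⟩ := exists_mul_mul_isPivot Finset.univ x (by simp)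
  choose σ hσ using h
  have hinj : Function.Injective σ := fun j j' hjj' => by
    by_contra hne
    exact (hσ j').1 (hjj' ▸ (hσ j).2.2 j' (Ne.symm hne))
  let π := Equiv.ofBijective σ (Finite.injective_iff_bijective.mp hinj)
  refine ⟨permGL F π⁻¹ * k, mul_mem ⟨permGL 𝒪[F] π⁻¹, map_permGL _ _⟩ hk, u, hu,
    fun j => (k * x * u).1 (σ j) j, fun j => (hσ j).1, Matrix.ext fun i j => ?_⟩
  rw [mul_assoc, mul_assoc, Units.val_mul, permGL_mul_apply, inv_inv, ← mul_assoc,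
    Matrix.diagonal_apply]
  split_ifs with hij
  · rw [hij]
    rfl
  · exact (hσ j).2.1 _ fun h => hij (hinj h)

theorem exists_blockTriangular_red_eq {b : GLk F n} (hb : b ∈ borel F n) :
    ∃ k : Matrix.GeneralLinearGroup (Fin n) 𝒪[F], red F n k = b ∧ k.1.BlockTriangular id := by
  obtain ⟨k, rfl⟩ := red_surjective F n b
  let M : Matrix (Fin n) (Fin n) 𝒪[F] := Matrix.of fun i j => if j < i then 0 else k i j
  have hM : M.map (IsLocalRing.residue 𝒪[F]) = (red F n k).1 := Matrix.ext fun i j => by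
    change IsLocalRing.residue 𝒪[F] (if j < i then 0 else k i j) = _
    split_ifs with hij
    · rw [map_zero, hb hij]
    · rfl
  have hdet : IsUnit M.det := by
    refine isUnit_of_map_unit (IsLocalRing.residue 𝒪[F]) _ ?_
    rw [RingHom.map_det, RingHom.mapMatrix_apply, hM]
    exact (Matrix.isUnit_iff_isUnit_det _).mp (red F n k).isUnit
  exact ⟨M.nonsingInvUnit hdet, Units.ext hM, fun i j hij => if_pos hij⟩

theorem conj_mem_iwahori {D : GLF F n} {d : Fin n → F} (hD : D.1 = Matrix.diagonal d)
    (hd : ∀ i, d i ≠ 0) {τ : Equiv.Perm (Fin n)}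
    (hτ : ∀ i j, τ⁻¹ i ≤ τ⁻¹ j → ValuativeRel.valuation F (d j) ≤ ValuativeRel.valuation F (d i) ∧
      (j < i → ValuativeRel.valuation F (d j) < ValuativeRel.valuation F (d i)))
    {c : Matrix.GeneralLinearGroup (Fin n) 𝒪[F]} (hc : c.1.BlockTriangular id) :
    D⁻¹ * incl F n (permGL 𝒪[F] τ * c * (permGL 𝒪[F] τ)⁻¹) * D ∈ iwahori F n := by
  have entry {c : Matrix.GeneralLinearGroup (Fin n) 𝒪[F]} (hc : c.1.BlockTriangular id) (i j) :
      ValuativeRel.valuation F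
          ((D⁻¹ * incl F n (permGL 𝒪[F] τ * c * (permGL 𝒪[F] τ)⁻¹) * D).1 i j) ≤ 1 ∧
        (j < i → ValuativeRel.valuation F
          ((D⁻¹ * incl F n (permGL 𝒪[F] τ * c * (permGL 𝒪[F] τ)⁻¹) * D).1 i j) < 1) := by
    rw [inv_mul_mul_apply_of_eq_diagonal hD hd, incl_apply, permGL_conj_apply, mul_right_comm,
      ← div_eq_inv_mul, map_mul, map_div₀]
    obtain hlt | hle := lt_or_ge (τ⁻¹ j) (τ⁻¹ i)
    · rw [show c.1 (τ⁻¹ i) (τ⁻¹ j) = 0 from hc hlt]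
      simp
    have hpos : 0 < ValuativeRel.valuation F (d i) := by simpa [zero_lt_iff] using hd i
    have hint : ValuativeRel.valuation F (c.1 (τ⁻¹ i) (τ⁻¹ j) : F) ≤ 1 := (c.1 _ _).2
    exact ⟨mul_le_one' ((div_le_one₀ hpos).mpr (hτ i j hle).1) hint, fun hji =>
      (mul_le_of_le_one_right' hint).trans_lt ((div_lt_one₀ hpos).mpr ((hτ i j hle).2 hji))⟩
  refine mem_iwahori_iff.mpr ⟨mem_maxCompact_iff.mpr ⟨fun i j => (entry hc i j).1, ?_⟩,
    fun i j => (entry hc i j).2⟩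
  have hinv : (D⁻¹ * incl F n (permGL 𝒪[F] τ * c * (permGL 𝒪[F] τ)⁻¹) * D)⁻¹ =
      D⁻¹ * incl F n (permGL 𝒪[F] τ * c⁻¹ * (permGL 𝒪[F] τ)⁻¹) * D := by
    simp [mul_assoc]
  rw [hinv]
  exact fun i j => (entry (blockTriangular_inv hc) i j).1

theorem exists_conj_borel (x : GLF F n) :
    ∃ y : GLk F n, ∀ b ∈ borel F n, ∃ k : Matrix.GeneralLinearGroup (Fin n) 𝒪[F],
      red F n k = y * b * y⁻¹ ∧ x⁻¹ * incl F n k * x ∈ iwahori F n := by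
  obtain ⟨_, ⟨k, rfl⟩, u, hu, d, hd, hD⟩ := exists_mul_mul_eq_diagonal x
  obtain ⟨τ, hτ⟩ := exists_perm_sorted fun i => ValuativeRel.valuation F (d i)
  refine ⟨(red F n k)⁻¹ * permGL 𝓀[F] τ, fun b hb => ?_⟩
  obtain ⟨c, rfl, hc⟩ := exists_blockTriangular_red_eq hb
  have hred : red F n (permGL 𝒪[F] τ) = permGL 𝓀[F] τ := map_permGL _ _
  refine ⟨k⁻¹ * (permGL 𝒪[F] τ * c * (permGL 𝒪[F] τ)⁻¹) * k, by simp [← hred, mul_assoc], ?_⟩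
  have hconj : x⁻¹ * incl F n (k⁻¹ * (permGL 𝒪[F] τ * c * (permGL 𝒪[F] τ)⁻¹) * k) * x =
      u * ((incl F n k * x * u)⁻¹ * incl F n (permGL 𝒪[F] τ * c * (permGL 𝒪[F] τ)⁻¹) *
        (incl F n k * x * u)) * u⁻¹ := by
    simp [mul_assoc]
  rw [hconj]
  exact mul_mem (mul_mem hu (conj_mem_iwahori hD hd hτ hc)) (inv_mem hu)

end Cartan

section Inflation

variable {F : Type*} [Field F] [ValuativeRel F] [TopologicalSpace F] [IsNonarchimedeanLocalField F]
  {n : ℕ} {R : Type*} [Field R]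

/-- The inflation of `z ∈ R[G_f]`: the function on `G` supported on `K`, where its value is the
coefficient of `z` at the reduction. It is a preimage of `z` in `H(K)`, see `toFinite_inflation`. -/
noncomputable def inflation (z : MonoidAlgebra R (GLk F n)) : HeckeAlgebra R (GLF F n) :=
  ⟨inflate (incl F n) (red F n) z.coeff, inflate_mem_heckeSubmodule (isReduction F n) _⟩

theorem inflation_mem_heckeK (z : MonoidAlgebra R (GLk F n)) : inflation z ∈ heckeK F n R :=
  fun _ hx => not_imp_comm.mp inflate_of_notMem_range hx

theorem inflation_incl (z : MonoidAlgebra R (GLk F n))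
    (k : Matrix.GeneralLinearGroup (Fin n) 𝒪[F]) :
    (inflation z).1 (incl F n k) = z.coeff (red F n k) :=
  inflate_apply incl_injective k

theorem inflation_mul_left (z : MonoidAlgebra R (GLk F n)) (x : GLF F n) :
    ∀ u ∈ proRadical F n, (inflation z).1 (u * x) = (inflation z).1 x :=
  inflate_mul_left_ker incl_injective x

theorem inflation_mul_right (z : MonoidAlgebra R (GLk F n)) (x : GLF F n) :
    ∀ u ∈ proRadical F n, (inflation z).1 (x * u) = (inflation z).1 x :=
  inflate_mul_right_ker incl_injective x

theorem toFinite_inflation (h₀ : IsNormalizing R (proRadical F n))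
    (z : MonoidAlgebra R (GLk F n)) : toFinite F n R (inflation z) = z := by
  have hc : IsCompact (proRadical F n : Set (GLF F n)) := (isReduction F n).isCompact_ker
  refine MonoidAlgebra.ext (Finsupp.ext fun q => ?_)
  change convolution R _ (convolution R _ _ (inflation z).1) _ _ = _
  rw [convolution_indicator_left h₀ hc (inflation z).2 (inflation_mul_left z),
    convolution_indicator_right h₀ hc (inflation_mul_right z), inflation_incl,
    Function.surjInv_eq (red_surjective F n)]

theorem tmul_mul_inflation (h₀ : IsNormalizing R (proRadical F n))
    (f : HeckeAlgebra R (GLF F n)) (z : MonoidAlgebra R (GLk F n)) :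
    tmul F n R (HeckeAlgebra.mul (proRadical F n) f (inflation z)) 1 = tmul F n R f z := by
  refine (Submodule.Quotient.eq _).mpr
    (Submodule.subset_span ⟨f, inflation z, inflation_mem_heckeK z, 1, ?_⟩)
  rw [toFinite_inflation h₀, mul_one]

theorem tmul_sum {ι : Type*} (s : Finset ι) (f : ι → HeckeAlgebra R (GLF F n))
    (z : MonoidAlgebra R (GLk F n)) :
    tmul F n R (∑ i ∈ s, f i) z = ∑ i ∈ s, tmul F n R (f i) z := by
  simp only [tmul, TensorProduct.sum_tmul, map_sum]

theorem act_mul_inflation (h₀ : IsNormalizing R (proRadical F n)) (f : HeckeAlgebra R (GLF F n))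
    (z : MonoidAlgebra R (GLk F n)) (v : CompactInd R (iwahori F n)) :
    act R (proRadical F n) (compactInd R (iwahori F n))
        (HeckeAlgebra.mul (proRadical F n) f (inflation z)).1 v =
      act R (proRadical F n) (compactInd R (iwahori F n)) f.1
        (act R (proRadical F n) (compactInd R (iwahori F n)) (inflation z).1 v) :=
  act_convolution h₀ (isSmooth_compactInd _ v) f.2 (inflation z).2

theorem mul_inflation_mem_annP (h₀ : IsNormalizing R (proRadical F n))
    {f : HeckeAlgebra R (GLF F n)} (hf : f ∈ annP F n R) (z : MonoidAlgebra R (GLk F n)) :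
    HeckeAlgebra.mul (proRadical F n) f (inflation z) ∈ annP F n R := fun v =>
  (act_mul_inflation h₀ f z v).trans (hf _)

theorem mul_inflation_mem_annP_of_mem_annPf (h₀ : IsNormalizing R (proRadical F n))
    (f : HeckeAlgebra R (GLF F n)) {z : MonoidAlgebra R (GLk F n)} (hz : z ∈ annPf F n R) :
    HeckeAlgebra.mul (proRadical F n) f (inflation z) ∈ annP F n R := by
  let _ := Fintype.ofFinite (GLk F n)
  intro v
  have hzero : act R (proRadical F n) (compactInd R (iwahori F n)) (inflation z).1 v = 0 :=
    act_inflate_eq_zero (isReduction F n) h₀ exists_conj_borel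
      (mem_annihilator_ind_trivial_iff.mp hz) v
  rw [act_mul_inflation h₀, hzero]
  exact act_of_apply_eq_zero fun g => map_zero _

theorem exists_eq_sum_mul_inflation_of_mem_annP (h₀ : IsNormalizing R (proRadical F n))
    {f : HeckeAlgebra R (GLF F n)} (hf : f ∈ annP F n R)
    (hinv : ∀ g, ∀ u ∈ proRadical F n, f.1 (g * u) = f.1 g) :
    ∃ (T : Finset (GLF F n ⧸ maxCompact F n))
      (a : GLF F n ⧸ maxCompact F n → HeckeAlgebra R (GLF F n))
      (z : GLF F n ⧸ maxCompact F n → MonoidAlgebra R (GLk F n)), (∀ x, z x ∈ annPf F n R) ∧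
      f = ∑ x ∈ T, HeckeAlgebra.mul (proRadical F n) (a x) (inflation (z x)) := by
  let _ := Fintype.ofFinite (GLk F n)
  have h := isReduction F n
  have hs := Function.surjInv_eq (red_surjective F n)
  have hc : IsCompact (proRadical F n : Set (GLF F n)) := h.isCompact_ker
  let e : HeckeAlgebra R (GLF F n) := ⟨_, indicator_mem_heckeSubmodule h₀.isOpen hc⟩
  let z (x : GLF F n ⧸ maxCompact F n) : MonoidAlgebra R (GLk F n) :=
    MonoidAlgebra.ofCoeff <| Finsupp.equivFunOnFinite.symm fun q =>
      f.1 (x.out * incl F n (Function.surjInv (red_surjective F n) q))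
  obtain ⟨T, hT⟩ := exists_eq_sum_leftTranslation_inflate h hs f hinv
  refine ⟨T, fun x => leftTranslation R _ x.out e, z, fun x => ?_, hT.trans ?_⟩
  · exact mem_annihilator_ind_trivial_iff.mpr (.of_act_eq_zero h h₀ hs f.2 hinv hf x.out)
  · refine Finset.sum_congr rfl fun x _ => Subtype.ext ?_
    refine .trans ?_ (convolution_leftTranslation h₀ e (inflation (z x)) x.out).symm
    rw [convolution_indicator_left h₀ hc (inflation (z x)).2 (inflation_mul_left (z x))]
    rfl

end Inflation

end Hecke

theorem mainTheorem3_general (F : Type*) [Field F] [ValuativeRel F] [TopologicalSpace F]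
    [IsNonarchimedeanLocalField F] (n : ℕ) (R : Type*) [Field R] (p : ℕ) [CharP 𝓀[F] p]
    (hp : (p : R) ≠ 0) :
    Hecke.tensorSpan F n R Set.univ (Hecke.annPf F n R : Set (MonoidAlgebra R (Hecke.GLk F n))) =
      Hecke.tensorSpan F n R (Hecke.annP F n R) Set.univ := by
  have h₀ : Hecke.IsNormalizing R (Hecke.proRadical F n) := Hecke.isNormalizing_proRadical hp
  apply le_antisymm <;> refine Submodule.span_le.mpr ?_
  · rintro _ ⟨f, -, z, hz, rfl⟩
    rw [← Hecke.tmul_mul_inflation h₀]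
    exact Submodule.subset_span
      ⟨_, Hecke.mul_inflation_mem_annP_of_mem_annPf h₀ f hz, 1, trivial, rfl⟩
  · rintro _ ⟨f, hf, z, -, rfl⟩
    obtain ⟨T, a, w, hw, hsum⟩ := Hecke.exists_eq_sum_mul_inflation_of_mem_annP h₀
      (Hecke.mul_inflation_mem_annP h₀ hf z)
      fun g _ => Hecke.convolution_mul_right_eq (Hecke.inflation_mul_right z) g
    rw [← Hecke.tmul_mul_inflation h₀, hsum, Hecke.tmul_sum]
    refine Submodule.sum_mem _ fun x _ => ?_
    rw [Hecke.tmul_mul_inflation h₀]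
    exact Submodule.subset_span ⟨_, trivial, w x, hw x, rfl⟩

theorem mainTheorem3 (F : Type*) [Field F] [ValuativeRel F] [TopologicalSpace F]
    [IsNonarchimedeanLocalField F] (n : ℕ) (R : Type*) [Field R] [IsAlgClosed R]
    (p l : ℕ) [CharP 𝓀[F] p] [CharP R l] (hlp : l ≠ p) :
    Hecke.tensorSpan F n R Set.univ (Hecke.annPf F n R : Set (MonoidAlgebra R (Hecke.GLk F n))) =
      Hecke.tensorSpan F n R (Hecke.annP F n R) Set.univ :=
  mainTheorem3_general F n R p
    (CharP.cast_ne_zero_of_ne_of_prime R (CharP.char_is_prime 𝓀[F] p) hlp)
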